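/- Let $T=(V,E)$ be a finite tree with root $r\in V$, and let its edges $(u,v)\in E$ be directed away from $r$. Nodes of degree one are called leaves and all other nodes are called inner; assume that every inner node has degree at least three. Let $Y=(Y_v)_{v\in V}$ be binary. The parameters $\theta\in[0,1]^{2|E|+1}$ are $\theta^{(r)}_1=P(Y_r=1)$ and $\theta^{(v)}_{1|b}=P(Y_v=1\mid Y_u=b)$ for $(u,v)\in E$ and $b\in\{0,1\}$ (with $\theta_0=1-\theta_1$), the joint distribution is $P_\theta(Y=\alpha)=\theta^{(r)}_{\alpha_r}\prod_{(u,v)\in E}\theta^{(v)}_{\alpha_v|\alpha_u}$, and $f_T(\theta)$ denotes the marginal distribution of $X=(Y_i)_{i\text{ leaf}}$. Put $\eta_{u,v}=\theta^{(v)}_{1|1}-\theta^{(v)}_{1|0}$ for $(u,v)\in E$ and $\bar\mu_v=1-2\,\mathbb E_\theta Y_v$ for $v\in V$. Let $\hat p$ be in the image of $f_T$, with means $\hat\lambda_i$, second and third central moments $\hat\mu_{ij}$, $\hat\mu_{ijk}$, and $\hat\mu_i=1-2\hat\lambda_i$; assume $\hat\lambda_i(1-\hat\lambda_i)\ne0$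 for every leaf $i$. The $\hat p$-fiber is $f_T^{-1}(\hat p)$. An edge $e$ is isolated if $\hat\mu_{ij}=0$ for all leaves $i,j$ whose connecting path contains $e$; $\widehat E$ is the set of isolated edges, and the $\hat p$-forest is $\widehat T=(V,E\setminus\widehat E)$. For edges $e,e'$ both in $\widehat E$ or both in $E\setminus\widehat E$ write $e\sim e'$ if $e=e'$, or if $e,e'$ share a node and all other edges sharing a node with each of them are isolated. Let $[\widehat E]$ and $[E\setminus\widehat E]$ be the sets of classes of the transitive closure of $\sim$. A node (or edge) separates two nodes in a forest if they lie in the same component and the path joining them contains that node (or edge); a node separates $i,j,k$ if it separates any two of them. Write $D_{ijk}=\hat\mu_{ijk}^2+4\hat\mu_{ij}\hat\mu_{ik}\hat\mu_{jk}$. Assume that every inner node of $T$ has degree at least three in $\widehat T$. Then: 1. All classes in $[\widehat E]$ and in $[E\setminus\widehat E]$ are singletons. 2. At every point of the $\hat p$-fiber, $\bar\mu_i=\hat\mu_i$ for every leaf $i$, and $\eta_{u,v}=0$ for every $(u,v)\in\widehat E$. 3. Let $v$ be an inner node. There are leaves $i,j,k$ separated by $v$ in $T$ with $\hat\mu_{ij}\hat\mu_{ik}\hat\mu_{jk}\ne0$.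 For any such leaves $D_{ijk}\neq 0$ and, at every point of the $\hat p$-fiber, $\bar\mu_v^2=\hat\mu_{ijk}^2/D_{ijk}$. 4. Let $(v,i)\in E\setminus\widehat E$ with $v$ inner and $i$ a leaf. There are leaves $j,k$ such that $v$ separates $i,j,k$ in $T$ and $\hat\mu_{jk}\neq0$. For any such leaves, at every point of the $\hat p$-fiber, $\eta_{v,i}^2=D_{ijk}/\hat\mu_{jk}^2$. 5. Let $(u,v)\in E\setminus\widehat E$ with $u,v$ inner. There are leaves $i,j,k,l$ such that, in $\widehat T$, $u$ separates $i$ from $j$, $v$ separates $k$ from $l$, and the edge $(u,v)$ separates each of $i,j$ from each of $k,l$. For any such leaves $\hat\mu_{ij}\ne0$, $D_{ikl}\neq0$ and, at every point of the $\hat p$-fiber, $$\eta_{u,v}^2=\frac{\hat\mu_{il}^2}{\hat\mu_{ij}^2}\cdot\frac{D_{ijk}}{D_{ikl}}.$$ 6. The parameters are identified up to label switching of the inner nodes: if $\theta$ is in the $\hat p$-fiber, then the $\hat p$-fiber consists exactly of the parameters obtained from $\theta$ by choosing a set $S$ of inner nodes and interchanging the labels $0$ and $1$ of $Y_v$ for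 all $v\in S$, that is, by replacing $\theta^{(r)}_1$ by $\theta^{(r)}_{0}$ if $r\in S$, and $\theta^{(v)}_{1|b}$ by $\theta^{(v)}_{\sigma_v(1)|\sigma_u(b)}$ for $(u,v)\in E$, where $\sigma_w(b)=1-b$ if $w\in S$ and $\sigma_w(b)=b$ otherwise. -/

import Mathlib

namespace TreeModel

/-! ### Trees -/

section Trees

variable {V : Type*} [Fintype V]

open Classical in
/-- The degree of a node. -/
noncomputable def deg (G : SimpleGraph V) (v : V) : ℕ := G.degree v

/-- A leaf is a node of degree one. -/
def IsLeaf (T : SimpleGraph V) (v : V) : Prop := deg T v = 1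

/-- An inner node is a node that is not a leaf. -/
def IsInner (T : SimpleGraph V) (v : V) : Prop := ¬ IsLeaf T v

/-- The set of leaves; it indexes the observed variables. -/
abbrev Leaf (T : SimpleGraph V) : Type _ := {v : V // IsLeaf T v}

/-- The edges of the tree `T`, directed away from the root `r`: the pairs `(u, v)` of adjacent
nodes such that `v` is one step further from `r` than `u`. -/
abbrev Arc (T : SimpleGraph V) (r : V) : Type _ :=
  {e : V × V // T.Adj e.1 e.2 ∧ T.dist r e.2 = T.dist r e.1 + 1}

/-- The undirected edge underlying a directed one. -/
def Arc.edge {T : SimpleGraph V} {r : V} (e : Arc T r) : Sym2 V := s(e.1.1, e.1.2)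

/-- `v` separates `i` and `j` in the forest `G`: they are joined by a path in `G`, and every such
path passes through `v`. (In a forest, nodes of different components do not count as separated
by `v`.) -/
def NodeSeparates (G : SimpleGraph V) (v i j : V) : Prop :=
  G.Reachable i j ∧ ∀ w : G.Walk i j, v ∈ w.support

/-- `v` separates the three nodes `i`, `j`, `k`, that is, any two of them. -/
def NodeSeparates₃ (G : SimpleGraph V) (v i j k : V) : Prop :=
  NodeSeparates G v i j ∧ NodeSeparates G v i k ∧ NodeSeparates G v j k

/-- The edge `e` separates `i` and `j` in the forest `G`: they are joined by a path in `G`, and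
every such path uses `e`. -/
def EdgeSeparates (G : SimpleGraph V) (e : Sym2 V) (i j : V) : Prop :=
  G.Reachable i j ∧ ∀ w : G.Walk i j, e ∈ w.edges

end Trees

/-! ### The general Markov model -/

section Model

variable {V : Type*} [Fintype V]

/-- The parameters of the general Markov model on `T` rooted at `r`: the number
`root = P(Y_r = 1)` and, for every directed edge `e = (u, v)` and every `b`, the number
`cond e b = P(Y_v = 1 | Y_u = b)`. Here `true` stands for `1` and `false` for `0`. -/
@[ext]
structure Param (T : SimpleGraph V) (r : V) where
  root : ℝ
  cond : Arc T r → Bool → ℝ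

/-- The parameter space `[0, 1] ^ (2 |E| + 1)`. -/
def paramSpace (T : SimpleGraph V) (r : V) : Set (Param T r) :=
  {θ | θ.root ∈ Set.Icc (0 : ℝ) 1 ∧ ∀ e b, θ.cond e b ∈ Set.Icc (0 : ℝ) 1}

/-- The probability of the value `a` of a binary variable that is `1` with probability `t`. -/
def bern (t : ℝ) (a : Bool) : ℝ := if a then t else 1 - t

/-- The numerical value of a binary variable. -/
def val (a : Bool) : ℝ := if a then 1 else 0

open Classical in
/-- The joint probability of the state `α` of all the nodes. -/
noncomputable def joint {T : SimpleGraph V} {r : V} (θ : Param T r) (α : V → Bool) : ℝ :=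
  bern θ.root (α r) * ∏ e : Arc T r, bern (θ.cond e (α e.1.1)) (α e.1.2)

open Classical in
/-- The probability mass function of the leaves, obtained from the joint one by summing over the
states of the inner nodes. -/
noncomputable def leafDist {T : SimpleGraph V} {r : V} (θ : Param T r) (β : Leaf T → Bool) : ℝ :=
  ∑ α : V → Bool with (∀ i : Leaf T, α i = β i), joint θ α

/-- The general Markov model: all distributions of the leaves that come from some parameter. -/
def model (T : SimpleGraph V) (r : V) : Set ((Leaf T → Bool) → ℝ) :=
  leafDist '' paramSpace T r

/-- The fiber of `p`: all parameters under which the leaves have the distribution `p`. -/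
def fiber (T : SimpleGraph V) (r : V) (p : (Leaf T → Bool) → ℝ) : Set (Param T r) :=
  {θ | θ ∈ paramSpace T r ∧ leafDist θ = p}

open Classical in
/-- The quantity `1 - 2 E(Y_v)`, for any node `v`. -/
noncomputable def muBar {T : SimpleGraph V} {r : V} (θ : Param T r) (v : V) : ℝ :=
  1 - 2 * ∑ α : V → Bool, joint θ α * val (α v)

/-- The quantity `P(Y_v = 1 | Y_u = 1) - P(Y_v = 1 | Y_u = 0)`, for a directed edge `(u, v)`. -/
def eta {T : SimpleGraph V} {r : V} (θ : Param T r) (e : Arc T r) : ℝ :=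
  θ.cond e true - θ.cond e false

open Classical in
/-- Switching the labels `0` and `1` of the variables at the nodes in `S`: the parameters of the
process in which `Y_v` is replaced by `1 - Y_v` for all `v` in `S`. -/
noncomputable def switch {T : SimpleGraph V} {r : V} (S : Set V) (θ : Param T r) : Param T r where
  root := if r ∈ S then 1 - θ.root else θ.root
  cond e b :=
    let t := θ.cond e (if e.1.1 ∈ S then !b else b)
    if e.1.2 ∈ S then 1 - t else t

end Model

/-! ### Observed moments and the forest -/

section Moments

variable {V : Type*} [Fintype V] {T : SimpleGraph V}

open Classical in
/-- The expectation of a function of the leaf variables. -/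
noncomputable def expect (p : (Leaf T → Bool) → ℝ) (f : (Leaf T → Bool) → ℝ) : ℝ :=
  ∑ β, p β * f β

/-- The mean of `X_i`. -/
noncomputable def mean (p : (Leaf T → Bool) → ℝ) (i : Leaf T) : ℝ :=
  expect p fun β => val (β i)

/-- The second central moment (covariance) of `X_i`, `X_j`. -/
noncomputable def mom₂ (p : (Leaf T → Bool) → ℝ) (i j : Leaf T) : ℝ :=
  expect p fun β => (val (β i) - mean p i) * (val (β j) - mean p j)

/-- The third central moment of `X_i`, `X_j`, `X_k`. -/
noncomputable def mom₃ (p : (Leaf T → Bool) → ℝ) (i j k : Leaf T) : ℝ :=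
  expect p fun β =>
    (val (β i) - mean p i) * (val (β j) - mean p j) * (val (β k) - mean p k)

/-- The expression `μ_ijk ^ 2 + 4 μ_ij μ_ik μ_jk`. -/
noncomputable def disc (p : (Leaf T → Bool) → ℝ) (i j k : Leaf T) : ℝ :=
  mom₃ p i j k ^ 2 + 4 * mom₂ p i j * mom₂ p i k * mom₂ p j k

/-- An edge `e` is isolated relative to `p` if `μ_ij = 0` for all leaves `i`, `j` such that `e`
lies on the path between `i` and `j`. -/
def Isolated (p : (Leaf T → Bool) → ℝ) (e : Sym2 V) : Prop :=
  ∀ i j : Leaf T, (∃ w : T.Walk (i : V) (j : V), w.IsPath ∧ e ∈ w.edges) → mom₂ p i j = 0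

/-- The `p`-forest: the isolated edges are removed from `T`, all nodes are kept. -/
def forest (p : (Leaf T → Bool) → ℝ) : SimpleGraph V :=
  T.deleteEdges {e | Isolated p e}

/-- The relation on edges, either both isolated or both not isolated: `e` and `e'` are equal, or
they share a node and all other edges that share a node with each of them are isolated. -/
def EdgeRel (p : (Leaf T → Bool) → ℝ) (e e' : Sym2 V) : Prop :=
  e ∈ T.edgeSet ∧ e' ∈ T.edgeSet ∧ (Isolated p e ↔ Isolated p e') ∧
    (e = e' ∨ (∃ x, x ∈ e ∧ x ∈ e') ∧
      ∀ g ∈ T.edgeSet, g ≠ e → g ≠ e' → (∃ x, x ∈ g ∧ x ∈ e) → (∃ x, x ∈ g ∧ x ∈ e') →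
        Isolated p g)

/-- The class of an edge under the transitive closure of `EdgeRel`. -/
def edgeClass (p : (Leaf T → Bool) → ℝ) (e : Sym2 V) : Set (Sym2 V) :=
  {e' | Relation.TransGen (EdgeRel p) e e'}

end Moments

end TreeModel

open TreeModel

/-! Everything reduces to covariances along the tree. If `v` separates `x` and `y`, then `Y_x` and
`Y_y` are independent given `Y_v`; as `Y_v` is binary this gives `cov x y * cov v v = cov x v * cov
v y` (`cov_mul_of_separates`), and for three separated nodes `cov₃ x y z * (cov v v)^2` is the
product of the three covariances with `v` times `muBar v` (`cov₃_mul_of_separates`). With `muBar v ^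
2 + 4 * cov v v = 1` these combine into `disc_mul`: the discriminant times `(cov v v)^4` is the
square of that product. Also `eta` is `cov u v / cov u u`, so the formulas for `muBar ^ 2` and `eta
^ 2` become algebra once no denominator vanishes.

Nonvanishing comes from the forest. A non-isolated edge lies between two correlated leaves, which
forces nonzero variance at its ends and nonzero covariance across it; covariances then stay nonzero
along forest paths. Since inner nodes have degree at least three in the forest, every direction in
the tree leads, after its first edge, through forest edges to a leaf (`exists_leaf_beyond`). This
supplies all the required leaves, shows that the covariance across an isolated edge is zero, and
makes the edge classes singletons.

For identifiability, the leaf distribution fixes the covariance of an inner variable with a chosen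
leaf up to sign, and switching labels at that node reverses the sign. After adjusting the signs by a
switch, the third moment fixes the mean of each inner variable, multiplicativity fixes its
covariances with all leaves and then with adjacent nodes, and these moments determine the parameters
(`param_eq_of_moments`). -/

namespace TreeModel

/-! ### Separation in trees -/

section Separation

variable {V : Type*} {T : SimpleGraph V}

/-- `x` and `y` are joined by a walk that does not visit `v`. -/
def JoinedOff (G : SimpleGraph V) (v x y : V) : Prop := ∃ w : G.Walk x y, v ∉ w.support

theorem JoinedOff.refl {v x : V} (h : v ≠ x) : JoinedOff T v x x :=
  ⟨.nil, by simpa using h⟩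

theorem JoinedOff.symm {v x y : V} (h : JoinedOff T v x y) : JoinedOff T v y x := by
  obtain ⟨w, hw⟩ := h
  exact ⟨w.reverse, by simpa using hw⟩

theorem JoinedOff.trans {v x y z : V} (h : JoinedOff T v x y) (h' : JoinedOff T v y z) :
    JoinedOff T v x z := by
  obtain ⟨w, hw⟩ := h
  obtain ⟨w', hw'⟩ := h'
  exact ⟨w.append w', by simp [SimpleGraph.Walk.mem_support_append_iff, hw, hw']⟩

theorem JoinedOff.ne_left {v x y : V} (h : JoinedOff T v x y) : v ≠ x := by
  obtain ⟨w, hw⟩ := h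
  rintro rfl
  exact hw w.start_mem_support

theorem JoinedOff.ne_right {v x y : V} (h : JoinedOff T v x y) : v ≠ y := h.symm.ne_left

theorem JoinedOff.of_adj {v x y : V} (h : T.Adj x y) (hx : v ≠ x) (hy : v ≠ y) :
    JoinedOff T v x y :=
  ⟨h.toWalk, by simp [hx, hy]⟩

theorem nodeSeparates_iff (hT : T.Connected) {v x y : V} :
    NodeSeparates T v x y ↔ ¬ JoinedOff T v x y := by
  simp [NodeSeparates, JoinedOff, hT.preconnected x y]

theorem nodeSeparates_comm {v x y : V} (h : NodeSeparates T v x y) : NodeSeparates T v y x :=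
  ⟨h.1.symm, fun w => by simpa using h.2 w.reverse⟩

theorem nodeSeparates_left (hT : T.Connected) (x y : V) : NodeSeparates T x x y :=
  ⟨hT.preconnected x y, fun w => w.start_mem_support⟩

/-- A path from `a` to `b` avoiding `v`, preceded by the edge from `v` to `a`, is a path from `v` to
its neighbour `b`; in a forest that path is the single edge. Thus neighbours of `v` index the
branches at `v`. -/
theorem eq_of_joinedOff_of_adj (hT : T.IsAcyclic) {v a b : V} (ha : T.Adj v a) (hb : T.Adj v b)
    (h : JoinedOff T v a b) : a = b := by
  classical
  obtain ⟨w, hw⟩ := h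
  have hp : (SimpleGraph.Walk.cons ha w.bypass).IsPath :=
    w.bypass_isPath.cons fun h => hw (w.support_bypass_subset_support h)
  have := hT.eq_snd_of_adj_start hp hb (by simp)
  simpa using this.symm

theorem nodeSeparates_of_isPath (hT : T.IsAcyclic) {v x y : V} {p : T.Walk x y} (hp : p.IsPath)
    (hv : v ∈ p.support) : NodeSeparates T v x y := by
  classical
  refine ⟨p.reachable, fun w => ?_⟩
  have : w.bypass = p :=
    congrArg Subtype.val ((hT.subsingleton_path x y).elim ⟨w.bypass, w.bypass_isPath⟩ ⟨p, hp⟩)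
  exact w.support_bypass_subset_support (this ▸ hv)

theorem nodeSeparates_of_le (hT : T.IsAcyclic) {F : SimpleGraph V} (hF : F ≤ T) {v x y : V}
    (h : NodeSeparates F v x y) : NodeSeparates T v x y := by
  obtain ⟨p, hp⟩ := h.1.exists_isPath
  exact nodeSeparates_of_isPath hT (hp.mapLe hF) (by simpa using h.2 p)

theorem nodeSeparates_of_ge {F : SimpleGraph V} (hF : F ≤ T) {v x y : V}
    (h : NodeSeparates T v x y) (hxy : F.Reachable x y) : NodeSeparates F v x y :=
  ⟨hxy, fun w => by simpa using h.2 (w.mapLe hF)⟩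

/-- For adjacent nodes `u`, `v` of a tree, any other node lies on the side of `u` or of `v`. -/
theorem joinedOff_or_joinedOff (hT : T.Connected) {u v : V} (h : u ≠ v) (x : V) :
    JoinedOff T u x v ∨ JoinedOff T v x u := by
  classical
  obtain ⟨p, hp⟩ := (hT.preconnected x u).exists_isPath
  by_cases hv : v ∈ p.support
  · exact .inl ⟨p.takeUntil v hv, SimpleGraph.Walk.endpoint_notMem_support_takeUntil hp hv h⟩
  · exact .inr ⟨p, hv⟩

/-- The nodes behind a neighbour `a` of `v` are in the branch of `a` at `v`. -/
theorem joinedOff_of_nodeSeparates (hT : T.IsTree) {v a b : V} (ha : T.Adj v a)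
    (h : NodeSeparates T a v b) : JoinedOff T v a b := by
  rcases joinedOff_or_joinedOff hT.connected ha.ne b with h' | h'
  · exact h'.symm
  · exact absurd h'.symm ((nodeSeparates_iff hT.connected).1 h)

theorem nodeSeparates_of_branches (hT : T.IsTree) {v a b x y : V} (ha : T.Adj v a)
    (hb : T.Adj v b) (hab : a ≠ b) (hx : NodeSeparates T a v x) (hy : NodeSeparates T b v y) :
    NodeSeparates T v x y := by
  rw [nodeSeparates_iff hT.connected]
  intro h
  exact hab (eq_of_joinedOff_of_adj hT.isAcyclic ha hb
    (((joinedOff_of_nodeSeparates hT ha hx).trans h).trans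
      (joinedOff_of_nodeSeparates hT hb hy).symm))

theorem edgeSeparates_of_nodeSeparates (hT : T.IsTree) {u v i k : V} (h : T.Adj u v)
    (hi : NodeSeparates T u v i) (hk : NodeSeparates T v u k) : EdgeSeparates T s(u, v) i k := by
  refine ⟨hT.connected.preconnected i k, fun w => ?_⟩
  obtain ⟨q₁, h₁⟩ := joinedOff_of_nodeSeparates hT h.symm hi
  obtain ⟨q₂, h₂⟩ := joinedOff_of_nodeSeparates hT h hk
  -- Extending `w` at both ends gives a walk from `u` to `v`, which must cross the bridge; the
  -- extensions avoid `v` and `u` respectively, so the crossing happens in `w`.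
  have hb : T.IsBridge s(u, v) := SimpleGraph.isAcyclic_iff_forall_isBridge.1 hT.isAcyclic h
  have := (SimpleGraph.isBridge_iff_forall_walk_mem_edges.1 hb)
    (q₁.append (w.append q₂.reverse))
  simp only [SimpleGraph.Walk.edges_append, SimpleGraph.Walk.edges_reverse, List.mem_append,
    List.mem_reverse] at this
  rcases this with h' | h' | h'
  · exact absurd (q₁.snd_mem_support_of_mem_edges h') h₁
  · exact h'
  · exact absurd (q₂.fst_mem_support_of_mem_edges h') h₂

theorem not_joinedOff_and_joinedOff (hT : T.IsAcyclic) {u v x : V} (h : T.Adj u v) :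
    ¬ (JoinedOff T u x v ∧ JoinedOff T v x u) := by
  classical
  rintro ⟨⟨w, hw⟩, ⟨w', hw'⟩⟩
  have hp : (w'.bypass.concat h).IsPath :=
    w'.bypass_isPath.concat (fun hv => hw' (w'.support_bypass_subset_support hv)) h
  exact hw ((nodeSeparates_of_isPath hT hp (v := u)
    (by simp [SimpleGraph.Walk.support_concat])).2 w)

theorem nodeSeparates_of_edgeSeparates (hT : T.IsAcyclic) {F : SimpleGraph V} (hF : F ≤ T)
    {u v i k : V} (h : EdgeSeparates F s(u, v) i k) :
    NodeSeparates T u i k ∧ NodeSeparates T v i k :=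
  ⟨nodeSeparates_of_le hT hF ⟨h.1, fun w => w.fst_mem_support_of_mem_edges (h.2 w)⟩,
    nodeSeparates_of_le hT hF ⟨h.1, fun w => w.snd_mem_support_of_mem_edges (h.2 w)⟩⟩

/-- A geodesic from `r` to a parent of `v` is too short to pass through `v`, so all parents lie in
the branch of `r` at `v`. -/
theorem parent_unique (hT : T.IsTree) {r u u' v : V} (hu : T.Adj u v) (hu' : T.Adj u' v)
    (h : T.dist r v = T.dist r u + 1) (h' : T.dist r v = T.dist r u' + 1) : u = u' := by
  have key : ∀ {x}, T.Adj x v → T.dist r v = T.dist r x + 1 → JoinedOff T v r x := by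
    intro x hx hd
    obtain ⟨p, hp, hl⟩ := hT.connected.exists_path_of_dist r x
    refine ⟨p, fun hv => ?_⟩
    classical
    have h1 := SimpleGraph.dist_le (p.takeUntil v hv)
    have h2 := p.length_takeUntil_le_length hv
    omega
  exact eq_of_joinedOff_of_adj hT.isAcyclic hu.symm hu'.symm ((key hu h).symm.trans (key hu' h'))

theorem exists_three_adj [Fintype V] {F : SimpleGraph V} {v : V} (h : 3 ≤ deg F v) :
    ∃ a b c, F.Adj v a ∧ F.Adj v b ∧ F.Adj v c ∧ a ≠ b ∧ a ≠ c ∧ b ≠ c := by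
  classical
  unfold deg at h
  rw [← SimpleGraph.card_neighborFinset_eq_degree] at h
  obtain ⟨a, b, c, ha, hb, hc, h⟩ := Finset.two_lt_card_iff.1 h
  exact ⟨a, b, c, by simpa using ha, by simpa using hb, by simpa using hc, h⟩

theorem exists_adj_ne [Fintype V] {F : SimpleGraph V} {v : V} (h : 3 ≤ deg F v) (x y : V) :
    ∃ a, F.Adj v a ∧ a ≠ x ∧ a ≠ y := by
  obtain ⟨a, b, c, ha, hb, hc, hab, hac, hbc⟩ := exists_three_adj h
  by_contra! hn
  have h1 := hn a ha
  have h2 := hn b hb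
  have h3 := hn c hc
  by_cases hx : a = x <;> by_cases hx' : b = x <;> grind

/-- Walking away from `u` in a subforest without end points at inner nodes, one reaches a leaf. -/
theorem exists_leaf_beyond [Fintype V] (hT : T.IsTree) {F : SimpleGraph V} (hF : F ≤ T)
    (hdeg : ∀ v, IsInner T v → 3 ≤ deg F v) {u v : V} (h : T.Adj u v) :
    ∃ b : Leaf T, F.Reachable v b ∧ NodeSeparates T v u b := by
  classical
  -- Take a node farthest from `u` among those reachable in `F` behind `v`. If it were inner, it
  -- would have a forest neighbour still farther away, since at most one neighbour is nearer to `u`.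
  obtain ⟨b, hb, hmax⟩ := Finset.exists_max_image
    ({b | F.Reachable v b ∧ NodeSeparates T v u b} : Finset V) (T.dist u)
    ⟨v, by simpa using nodeSeparates_comm (nodeSeparates_left hT.connected v u)⟩
  simp only [Finset.mem_filter, Finset.mem_univ, true_and] at hb hmax
  by_cases hl : IsLeaf T b
  · exact ⟨⟨b, hl⟩, hb⟩
  exfalso
  obtain ⟨b₁, b₂, -, h1, h2, -, hne, -⟩ := exists_three_adj (hdeg b hl)
  have hfar : ∃ c, F.Adj b c ∧ T.dist u c = T.dist u b + 1 := by
    by_contra! hn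
    have e1 := (hT.dist_eq_dist_add_one_of_adj u (hF h1)).resolve_right (hn _ h1)
    have e2 := (hT.dist_eq_dist_add_one_of_adj u (hF h2)).resolve_right (hn _ h2)
    exact hne (parent_unique hT (hF h1).symm (hF h2).symm e1 e2)
  obtain ⟨c, hc, hd⟩ := hfar
  have := hmax c ⟨hb.1.trans hc.reachable, (nodeSeparates_iff hT.connected).2 fun hj => ?_⟩
  · omega
  by_cases hvb : v = b
  · subst hvb
    have := eq_of_joinedOff_of_adj hT.isAcyclic h.symm (hF hc) hj
    subst this
    simp at hd
  · exact (nodeSeparates_iff hT.connected).1 hb.2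
      (hj.trans (.of_adj (hF hc).symm hj.ne_right hvb))

end Separation

/-! ### Conditional independence -/

section Markov

variable {V : Type*}

/-- `f` depends only on the states of the nodes in `A`. -/
def DependsOnlyOn (A : Set V) (f : (V → Bool) → ℝ) : Prop :=
  ∀ α β : V → Bool, (∀ x ∈ A, α x = β x) → f α = f β

theorem DependsOnlyOn.mono {A B : Set V} {f : (V → Bool) → ℝ} (h : DependsOnlyOn A f)
    (hAB : A ⊆ B) : DependsOnlyOn B f :=
  fun α β hαβ => h α β fun x hx => hαβ x (hAB hx)

theorem DependsOnlyOn.mul {A : Set V} {f g : (V → Bool) → ℝ} (hf : DependsOnlyOn A f)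
    (hg : DependsOnlyOn A g) : DependsOnlyOn A fun α => f α * g α :=
  fun α β h => by simp only [hf α β h, hg α β h]

open Classical in
/-- The pair of states obtained from a pair by exchanging the states of the nodes outside `A`. -/
noncomputable def exchange (A : Set V) (q : (V → Bool) × (V → Bool)) : (V → Bool) × (V → Bool) :=
  (fun x => if x ∈ A then q.1 x else q.2 x, fun x => if x ∈ A then q.2 x else q.1 x)

theorem exchange_involutive (A : Set V) : Function.Involutive (exchange A) := by
  rintro ⟨α, α'⟩
  ext x <;> by_cases h : x ∈ A <;> simp [exchange, h]

variable [Fintype V] {T : SimpleGraph V} {r : V}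

open Classical in
/-- The sum of a function of all the nodes against the joint weights. -/
noncomputable def expectAll (θ : Param T r) (f : (V → Bool) → ℝ) : ℝ :=
  ∑ α : V → Bool, joint θ α * f α

theorem expectAll_add (θ : Param T r) (f g : (V → Bool) → ℝ) :
    expectAll θ (fun α => f α + g α) = expectAll θ f + expectAll θ g := by
  simp [expectAll, mul_add, Finset.sum_add_distrib]

theorem expectAll_sub (θ : Param T r) (f g : (V → Bool) → ℝ) :
    expectAll θ (fun α => f α - g α) = expectAll θ f - expectAll θ g := by
  simp [expectAll, mul_sub, Finset.sum_sub_distrib]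

theorem expectAll_const_mul (θ : Param T r) (c : ℝ) (f : (V → Bool) → ℝ) :
    expectAll θ (fun α => c * f α) = c * expectAll θ f := by
  simp [expectAll, Finset.mul_sum, mul_left_comm]

/-- No edge joins `A` to the outside except at `v`, where the two states agree. Hence each edge
factor sees either no change or a plain interchange of the two states. -/
theorem joint_exchange (θ : Param T r) {A : Set V} {v : V} (hv : v ∉ A)
    (hA : ∀ x y, T.Adj x y → x ∈ A → y ∈ A ∨ y = v) (q : (V → Bool) × (V → Bool))
    (hq : q.1 v = q.2 v) :
    joint θ (exchange A q).1 * joint θ (exchange A q).2 = joint θ q.1 * joint θ q.2 := by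
  classical
  obtain ⟨α, α'⟩ := q
  simp only at hq
  unfold joint
  rw [mul_mul_mul_comm, ← Finset.prod_mul_distrib, mul_mul_mul_comm, ← Finset.prod_mul_distrib]
  congr 1
  · by_cases h : r ∈ A <;> simp [exchange, h, mul_comm]
  · refine Finset.prod_congr rfl fun e _ => ?_
    by_cases hx : e.1.1 ∈ A <;> by_cases hy : e.1.2 ∈ A
    · simp [exchange, hx, hy]
    · have hyv := (hA _ _ e.2.1 hx).resolve_left hy
      simp [exchange, hx, hyv, hv, hq]
    · have hxv := (hA _ _ e.2.1.symm hy).resolve_left hx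
      simp [exchange, hxv, hy, hv, hq]
    · simp [exchange, hx, hy, mul_comm]

open Classical in
/-- The indicator of `Y_v = b`. -/
noncomputable def ind (v : V) (b : Bool) (α : V → Bool) : ℝ := if α v = b then 1 else 0

/-- Both sides are sums over pairs of independent copies of the process. Only pairs with both copies
equal to `b` at `v` contribute, and on these `exchange A` preserves the weight while moving the
argument of `g` to the other copy. No division is needed, so null events are allowed. -/
theorem expectAll_markov (θ : Param T r) {A : Set V} {v : V} (hv : v ∉ A)
    (hA : ∀ x y, T.Adj x y → x ∈ A → y ∈ A ∨ y = v) {f g : (V → Bool) → ℝ}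
    (hf : DependsOnlyOn (insert v A) f) (hg : DependsOnlyOn Aᶜ g) (b : Bool) :
    expectAll θ (fun α => f α * g α * ind v b α) * expectAll θ (ind v b) =
      expectAll θ (fun α => f α * ind v b α) * expectAll θ (fun α => g α * ind v b α) := by
  classical
  unfold expectAll
  rw [Finset.sum_mul_sum, Finset.sum_mul_sum, ← Finset.sum_product', ← Finset.sum_product',
    Finset.univ_product_univ,
    ← Equiv.sum_comp (exchange_involutive A).toPerm]
  refine Finset.sum_congr rfl fun q _ => ?_
  have e1 : (exchange A q).1 v = q.2 v := by simp [exchange, hv]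
  have e2 : (exchange A q).2 v = q.1 v := by simp [exchange, hv]
  simp only [Function.Involutive.coe_toPerm, ind, e1, e2]
  by_cases h1 : q.1 v = b <;> by_cases h2 : q.2 v = b
  · have hj := joint_exchange θ hv hA q (h1.trans h2.symm)
    have hf' : f (exchange A q).1 = f q.1 := by
      refine hf _ _ fun x hx => ?_
      rcases hx with rfl | hx
      · rw [e1, h1, h2]
      · simp [exchange, hx]
    have hg' : g (exchange A q).1 = g q.2 := by
      refine hg _ _ fun x hx => ?_
      have : x ∉ A := hx
      simp [exchange, this]
    simp only [h1, h2, hf', hg', if_true, mul_one]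
    linear_combination f q.1 * g q.2 * hj
  all_goals simp [h1, h2]

/-- If `v` separates `x` from the nodes in `B`, then the state of `x` and those of the nodes in `B`
are independent given the state of `v`. -/
theorem expectAll_condIndep (θ : Param T r) {v x : V} {B : Set V}
    (hB : ∀ y ∈ B, NodeSeparates T v x y) {f g : (V → Bool) → ℝ}
    (hf : DependsOnlyOn {x} f) (hg : DependsOnlyOn B g) (b : Bool) :
    expectAll θ (fun α => f α * g α * ind v b α) * expectAll θ (ind v b) =
      expectAll θ (fun α => f α * ind v b α) * expectAll θ (fun α => g α * ind v b α) := by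
  -- `A` is the branch of `x` at `v`; it is empty when `x = v`, which is why `f` may also depend on
  -- `v`.
  refine expectAll_markov θ (A := {z | JoinedOff T v x z}) (fun h => h.ne_right rfl) ?_
    (hf.mono ?_) (hg.mono ?_) b
  · intro y z hyz hy
    by_cases hz : v = z
    · exact .inr hz.symm
    · exact .inl (hy.trans (.of_adj hyz hy.ne_right hz))
  · rintro z (rfl : z = x)
    by_cases h : v = z
    · exact .inl h.symm
    · exact .inr (.refl h)
  · rintro y hy ⟨w, hw⟩
    exact hw ((hB y hy).2 w)

end Markov

/-! ### Bernoulli networks -/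

section Network

variable {V : Type*}

open Classical in
/-- The product of the conditional probabilities of the nodes in `U`, for success probabilities `t`
that depend on the states of other nodes. -/
noncomputable def netWeight (t : V → (V → Bool) → ℝ) (U : Finset V) (α : V → Bool) : ℝ :=
  ∏ x ∈ U, bern (t x α) (α x)

variable {t : V → (V → Bool) → ℝ} {d : V → ℕ}

theorem netWeight_update (ht : ∀ x, DependsOnlyOn {y | d y < d x} (t x)) {U : Finset V} {x : V}
    (hx : x ∉ U) (hU : ∀ y ∈ U, ∀ z, d z < d y → z ∈ U) (α : V → Bool) (b : Bool) :
    netWeight t U (open Classical in Function.update α x b) = netWeight t U α := by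
  classical
  refine Finset.prod_congr rfl fun y hy => ?_
  have hyx : y ≠ x := fun h => hx (h ▸ hy)
  rw [Function.update_of_ne hyx, ht y (Function.update α x b) α]
  rintro z hz
  rw [Function.update_of_ne]
  rintro rfl
  exact hx (hU y hy _ hz)

variable [Fintype V]

-- Flipping the coordinate `x` is an involution on states, and a state and its flip are the two
-- updates at `x`.
open Classical in
theorem two_mul_sum_eq_sum_update (x : V) (h : (V → Bool) → ℝ) :
    2 * ∑ α : V → Bool, h α =
      ∑ α : V → Bool, (h (Function.update α x true) + h (Function.update α x false)) := by
  have hinv : Function.Involutive fun α : V → Bool => Function.update α x (!(α x)) := by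
    intro α
    simp
  have := Equiv.sum_comp hinv.toPerm h
  rw [two_mul]
  nth_rewrite 2 [← this]
  rw [← Finset.sum_add_distrib]
  refine Finset.sum_congr rfl fun α _ => ?_
  have hself : Function.update α x (α x) = α := Function.update_eq_self x α
  cases hα : α x <;> rw [hα] at hself
  · rw [add_comm, hself]
    simp [hα]
  · rw [hself]
    simp [hα]

open Classical in
/-- Summing out one node. -/
theorem two_mul_sum_netWeight_insert (ht : ∀ x, DependsOnlyOn {y | d y < d x} (t x))
    {U : Finset V} {x : V} (hx : x ∉ U) (hU : ∀ y ∈ U, ∀ z, d z < d y → z ∈ U)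
    (f : (V → Bool) → ℝ) :
    2 * ∑ α, netWeight t (insert x U) α * f α =
      ∑ α, netWeight t U α * (t x α * f (Function.update α x true) +
        (1 - t x α) * f (Function.update α x false)) := by
  rw [two_mul_sum_eq_sum_update x]
  refine Finset.sum_congr rfl fun α _ => ?_
  have hw : ∀ b, netWeight t (insert x U) (Function.update α x b) =
      bern (t x α) b * netWeight t U α := by
    intro b
    have := netWeight_update ht hx hU α b
    unfold netWeight at this ⊢
    rw [Finset.prod_insert hx, this, Function.update_self, ht x (Function.update α x b) α]
    intro y hy
    rw [Function.update_of_ne]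
    rintro rfl
    simp at hy
  rw [hw, hw]
  simp only [bern]
  simp
  ring

-- The sums range over states of all nodes even when the weight involves only `U`, so each node
-- outside `U` that is summed out costs a factor 2.
open Classical in
theorem sum_netWeight_univ (ht : ∀ x, DependsOnlyOn {y | d y < d x} (t x)) {U : Finset V}
    (hU : ∀ y ∈ U, ∀ z, d z < d y → z ∈ U) {f : (V → Bool) → ℝ} (hf : DependsOnlyOn U f) :
    2 ^ (Uᶜ).card * ∑ α, netWeight t Finset.univ α * f α = ∑ α, netWeight t U α * f α := by
  induction hn : (Uᶜ).card generalizing U with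
  | zero =>
    have : U = Finset.univ := by simpa using hn
    simp [this]
  | succ n ih =>
    have hne : (Uᶜ).Nonempty := by
      rw [← Finset.card_pos]
      omega
    -- Adding a missing node of minimal rank keeps the set closed under passing to lower rank.
    obtain ⟨x, hx, hmin⟩ := Finset.exists_min_image _ d hne
    have hxU : x ∉ U := by simpa using hx
    have hU' : ∀ y ∈ insert x U, ∀ z, d z < d y → z ∈ insert x U := by
      intro y hy z hz
      rcases Finset.mem_insert.1 hy with rfl | hy
      · by_contra h
        have := hmin z (by simpa using fun h' => h (Finset.mem_insert_of_mem h'))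
        omega
      · exact Finset.mem_insert_of_mem (hU y hy z hz)
    have := ih hU' (hf.mono (by simp)) (by
      have := Finset.card_compl_add_card U
      have := Finset.card_compl_add_card (insert x U)
      rw [Finset.card_insert_of_notMem hxU] at this
      omega)
    rw [pow_succ', mul_assoc, this, two_mul_sum_netWeight_insert ht hxU hU]
    refine Finset.sum_congr rfl fun α _ => ?_
    have hfu : ∀ b, f (Function.update α x b) = f α := fun b => hf _ _ fun y hy => by
      rw [Function.update_of_ne]
      rintro rfl
      exact hxU hy
    rw [hfu, hfu]
    ring

open Classical in
theorem sum_netWeight_eq_one (ht : ∀ x, DependsOnlyOn {y | d y < d x} (t x)) :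
    ∑ α, netWeight t Finset.univ α = 1 := by
  have := sum_netWeight_univ ht (U := ∅) (by simp) (f := fun _ => 1) (fun _ _ _ => rfl)
  simp [netWeight] at this ⊢
  have h2 : (2 : ℝ) ^ Fintype.card V ≠ 0 := by positivity
  exact mul_left_cancel₀ h2 (by rw [this, mul_one])

open Classical in
/-- Given the nodes of lower rank, the node `x` has conditional mean `t x`. -/
theorem sum_netWeight_mul_val (ht : ∀ x, DependsOnlyOn {y | d y < d x} (t x)) (x : V)
    {f : (V → Bool) → ℝ} (hf : DependsOnlyOn {y | d y < d x} f) :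
    ∑ α, netWeight t Finset.univ α * (f α * val (α x)) =
      ∑ α, netWeight t Finset.univ α * (f α * t x α) := by
  set U : Finset V := {y | d y < d x} with hUdef
  have hxU : x ∉ U := by simp [hUdef]
  have hU : ∀ y ∈ U, ∀ z, d z < d y → z ∈ U := by
    intro y hy z hz
    simp only [hUdef, Finset.mem_filter, Finset.mem_univ, true_and] at hy ⊢
    omega
  have hU' : ∀ y ∈ insert x U, ∀ z, d z < d y → z ∈ insert x U := by
    intro y hy z hz
    simp only [hUdef, Finset.mem_insert, Finset.mem_filter, Finset.mem_univ, true_and] at hy ⊢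
    rcases hy with rfl | hy <;> right <;> omega
  have hg : DependsOnlyOn (insert x U : Finset V) fun α => f α * (val (α x) - t x α) := by
    intro α β h
    have hlt : ∀ y ∈ {y | d y < d x}, α y = β y := fun y hy => h y (by simp [hUdef]; exact .inr hy)
    simp only [hf α β hlt, ht x α β hlt, h x (by simp)]
  have key := sum_netWeight_univ ht hU' hg
  have h0 := two_mul_sum_netWeight_insert ht hxU hU fun α => f α * (val (α x) - t x α)
  -- Summing out `x` first: its deviation from `t x` averages to zero for every fixed state of the
  -- lower-ranked nodes.
  have hz : ∑ α, netWeight t (insert x U) α * (f α * (val (α x) - t x α)) = 0 := by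
    refine (mul_eq_zero.1 (h0.trans (Finset.sum_eq_zero fun α _ => ?_))).resolve_left two_ne_zero
    have hu : ∀ b, ∀ y ∈ {y | d y < d x}, Function.update α x b y = α y := by
      intro b y hy
      rw [Function.update_of_ne]
      rintro rfl
      simp at hy
    rw [hf _ _ (hu true), hf _ _ (hu false), ht x _ _ (hu true), ht x _ _ (hu false)]
    simp [val]
    right
    ring
  rw [hz] at key
  have := (mul_eq_zero.1 key).resolve_left (by positivity)
  rw [← sub_eq_zero, ← Finset.sum_sub_distrib, ← this]
  exact Finset.sum_congr rfl fun α _ => by ring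

end Network

/-! ### Moments of the tree model -/

section Parents

variable {V : Type*} {T : SimpleGraph V} {r : V}

theorem arc_ext (hT : T.IsTree) {e e' : Arc T r} (h : e.1.2 = e'.1.2) : e = e' := by
  obtain ⟨⟨u, v⟩, hadj, hd⟩ := e
  obtain ⟨⟨u', v'⟩, hadj', hd'⟩ := e'
  simp only at h hadj hd hadj' hd'
  subst h
  obtain rfl := parent_unique hT hadj hadj' hd hd'
  rfl

theorem exists_arc (hT : T.IsTree) {x : V} (hx : x ≠ r) : ∃ e : Arc T r, e.1.2 = x := by
  obtain ⟨p, hp, hl⟩ := hT.connected.exists_path_of_dist r x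
  have hnil : ¬ p.Nil := fun h => hx h.eq.symm
  have hadj := p.adj_penultimate hnil
  have h1 := SimpleGraph.dist_le p.dropLast
  have h2 : p.dropLast.length + 1 = p.length := by
    rw [SimpleGraph.Walk.length_dropLast_add_one hnil]
  rcases hT.dist_eq_dist_add_one_of_adj r hadj with h | h
  · omega
  · exact ⟨⟨(p.penultimate, x), hadj, h⟩, rfl⟩

open Classical in
/-- The probability that `Y_x = 1`, given the state of the parent of `x`. -/
noncomputable def successProb (θ : Param T r) (x : V) (α : V → Bool) : ℝ :=
  if h : ∃ e : Arc T r, e.1.2 = x then θ.cond h.choose (α h.choose.1.1) else θ.root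

theorem successProb_root (θ : Param T r) (α : V → Bool) : successProb θ r α = θ.root := by
  refine dif_neg ?_
  rintro ⟨⟨⟨u, v⟩, h, hd⟩, hv⟩
  simp only at hv hd
  subst hv
  simp at hd

theorem successProb_arc (hT : T.IsTree) (θ : Param T r) (e : Arc T r) (α : V → Bool) :
    successProb θ e.1.2 α = θ.cond e (α e.1.1) := by
  have h : ∃ e' : Arc T r, e'.1.2 = e.1.2 := ⟨e, rfl⟩
  have he : h.choose = e := arc_ext hT h.choose_spec
  rw [successProb, dif_pos h, he]

theorem dependsOnlyOn_successProb (θ : Param T r) (x : V) :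
    DependsOnlyOn {y | T.dist r y < T.dist r x} (successProb θ x) := by
  intro α β h
  unfold successProb
  split_ifs with hx
  · rw [h]
    have h1 := hx.choose.2.2
    have h2 := hx.choose_spec
    rw [h2] at h1
    simp only [Set.mem_ofPred_eq]
    omega
  · rfl

theorem ind_true {V : Type*} (v : V) (α : V → Bool) : ind v true α = val (α v) := rfl

theorem ind_false {V : Type*} (v : V) (α : V → Bool) : ind v false α = 1 - val (α v) := by
  cases h : α v <;> simp [ind, val, h]

end Parents

section Moments

variable {V : Type*} [Fintype V] {T : SimpleGraph V} {r : V}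

/-- Every node other than the root is the head of exactly one arc, so arcs can be replaced by nodes.
The rank for the network is the distance from the root. -/
theorem joint_eq_netWeight (hT : T.IsTree) (θ : Param T r) (α : V → Bool) :
    joint θ α = netWeight (successProb θ) Finset.univ α := by
  classical
  unfold joint netWeight
  rw [← Finset.mul_prod_erase Finset.univ _ (Finset.mem_univ r), successProb_root]
  congr 1
  refine Finset.prod_bij (fun e _ => e.1.2) ?_ (fun e _ e' _ h => arc_ext hT h) ?_ ?_
  · rintro ⟨⟨u, v⟩, h, hd⟩ -
    simp only [Finset.mem_erase, Finset.mem_univ, and_true]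
    rintro rfl
    simp at hd
  · intro x hx
    obtain ⟨e, he⟩ := exists_arc hT (Finset.ne_of_mem_erase hx)
    exact ⟨e, Finset.mem_univ e, he⟩
  · intro e _
    rw [successProb_arc hT]

theorem expectAll_eq_sum_netWeight (hT : T.IsTree) (θ : Param T r) (f : (V → Bool) → ℝ) :
    expectAll θ f =
      open Classical in ∑ α, netWeight (successProb θ) Finset.univ α * f α := by
  unfold expectAll
  simp only [joint_eq_netWeight hT]

theorem expectAll_const (hT : T.IsTree) (θ : Param T r) (c : ℝ) :
    expectAll θ (fun _ => c) = c := by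
  have := sum_netWeight_eq_one (dependsOnlyOn_successProb θ)
  rw [expectAll_eq_sum_netWeight hT, ← Finset.sum_mul, this, one_mul]

/-- The mean of `Y_v`. -/
noncomputable def meanAt (θ : Param T r) (v : V) : ℝ := expectAll θ fun α => val (α v)

/-- The centred variable at the node `v`. -/
noncomputable def centred (θ : Param T r) (v : V) (α : V → Bool) : ℝ := val (α v) - meanAt θ v

/-- The covariance of `Y_x` and `Y_y`. -/
noncomputable def cov (θ : Param T r) (x y : V) : ℝ :=
  expectAll θ fun α => centred θ x α * centred θ y α

/-- The third central moment of `Y_x`, `Y_y` and `Y_z`. -/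
noncomputable def cov₃ (θ : Param T r) (x y z : V) : ℝ :=
  expectAll θ fun α => centred θ x α * centred θ y α * centred θ z α

theorem muBar_eq (θ : Param T r) (v : V) : muBar θ v = 1 - 2 * meanAt θ v := rfl

theorem cov_comm (θ : Param T r) (x y : V) : cov θ x y = cov θ y x := by
  simp only [cov, mul_comm]

theorem expectAll_centred (hT : T.IsTree) (θ : Param T r) (v : V) :
    expectAll θ (centred θ v) = 0 := by
  have := expectAll_sub θ (fun α => val (α v)) fun _ => meanAt θ v
  rw [expectAll_const hT] at this
  exact this.trans (sub_self _)

theorem expectAll_ind_true (θ : Param T r) (v : V) : expectAll θ (ind v true) = meanAt θ v := rfl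

theorem expectAll_ind_false (hT : T.IsTree) (θ : Param T r) (v : V) :
    expectAll θ (ind v false) = 1 - meanAt θ v := by
  have := expectAll_sub θ (fun _ => 1) fun α => val (α v)
  rw [expectAll_const hT] at this
  rw [meanAt, ← this]
  exact congrArg _ (funext fun α => ind_false v α)

theorem expectAll_split (θ : Param T r) (v : V) (f : (V → Bool) → ℝ) :
    expectAll θ (fun α => f α * ind v true α) + expectAll θ (fun α => f α * ind v false α) =
      expectAll θ f := by
  rw [← expectAll_add]
  refine congrArg _ (funext fun α => ?_)
  rw [ind_true, ind_false]
  ring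

theorem expectAll_centred_mul_ind (hT : T.IsTree) (θ : Param T r) (x v : V) :
    expectAll θ (fun α => centred θ x α * ind v true α) = cov θ x v := by
  have h := expectAll_sub θ (fun α => centred θ x α * ind v true α)
    fun α => meanAt θ v * centred θ x α
  rw [expectAll_const_mul, expectAll_centred hT, mul_zero, sub_zero] at h
  rw [← h]
  refine congrArg _ (funext fun α => ?_)
  rw [ind_true, centred, centred]
  ring

theorem expectAll_centred_mul_ind_false (hT : T.IsTree) (θ : Param T r) (x v : V) :
    expectAll θ (fun α => centred θ x α * ind v false α) = - cov θ x v := by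
  have := expectAll_split θ v (centred θ x)
  rw [expectAll_centred_mul_ind hT, expectAll_centred hT] at this
  linarith

theorem cov_self (hT : T.IsTree) (θ : Param T r) (v : V) :
    cov θ v v = meanAt θ v * (1 - meanAt θ v) := by
  rw [← expectAll_centred_mul_ind hT]
  have h := expectAll_const_mul θ (1 - meanAt θ v) fun α => val (α v)
  rw [mul_comm] at h
  refine Eq.trans (congrArg _ (funext fun α => ?_)) h
  cases hα : α v <;> simp [ind, val, hα, centred]

theorem dependsOnlyOn_centred (θ : Param T r) (x : V) : DependsOnlyOn {x} (centred θ x) := by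
  intro α β h
  rw [centred, centred, h x rfl]

theorem cov_mul_of_separates (hT : T.IsTree) (θ : Param T r) {v x y : V}
    (h : NodeSeparates T v x y) : cov θ x y * cov θ v v = cov θ x v * cov θ v y := by
  have hb := expectAll_condIndep θ (B := {y}) (by simpa using h) (dependsOnlyOn_centred θ x)
    (dependsOnlyOn_centred θ y)
  have ht := hb true
  have hf := hb false
  rw [expectAll_ind_true, expectAll_centred_mul_ind hT, expectAll_centred_mul_ind hT] at ht
  rw [expectAll_ind_false hT, expectAll_centred_mul_ind_false hT,
    expectAll_centred_mul_ind_false hT] at hf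
  rw [cov_self hT, cov_comm θ v y]
  have hs := expectAll_split θ v fun α => centred θ x α * centred θ y α
  rw [cov, ← hs]
  -- The two conditional identities are weighted by the probability of the opposite value of `Y_v`,
  -- so that both acquire the factor `cov v v`.
  linear_combination (1 - meanAt θ v) * ht + meanAt θ v * hf

theorem cov₃_mul_of_separates (hT : T.IsTree) (θ : Param T r) {v x y z : V}
    (h : NodeSeparates₃ T v x y z) :
    cov₃ θ x y z * cov θ v v ^ 2 = cov θ x v * cov θ y v * cov θ z v * muBar θ v := by
  have hb := expectAll_condIndep θ (v := v) (x := y) (B := {z}) (by simpa using h.2.2)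
    (dependsOnlyOn_centred θ y) (dependsOnlyOn_centred θ z)
  have hb' := expectAll_condIndep θ (v := v) (x := x) (B := {y, z})
    (by simpa using ⟨h.1, h.2.1⟩) (dependsOnlyOn_centred θ x)
    (((dependsOnlyOn_centred θ y).mono (by simp)).mul ((dependsOnlyOn_centred θ z).mono (by simp)))
  have ht := hb true
  have hf := hb false
  have ht' := hb' true
  have hf' := hb' false
  rw [expectAll_ind_true] at ht ht'
  rw [expectAll_ind_false hT] at hf hf'
  rw [expectAll_centred_mul_ind hT] at ht'
  rw [expectAll_centred_mul_ind_false hT] at hf'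
  rw [expectAll_centred_mul_ind hT, expectAll_centred_mul_ind hT] at ht
  rw [expectAll_centred_mul_ind_false hT, expectAll_centred_mul_ind_false hT] at hf
  rw [cov_self hT, muBar_eq]
  have hs := expectAll_split θ v fun α => centred θ x α * (centred θ y α * centred θ z α)
  have : cov₃ θ x y z = expectAll θ fun α => centred θ x α * (centred θ y α * centred θ z α) := by
    simp only [cov₃, mul_assoc]
  rw [this, ← hs]
  set m := meanAt θ v
  -- For each value of `Y_v`, `ht'` and `hf'` split off `x`, then `ht` and `hf` split `y` from `z`.
  -- The sign of the `false` terms produces the factor `(1 - m) - m`, which is `muBar`.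
  linear_combination (1 - m) ^ 2 * m * ht' + (1 - m) ^ 2 * cov θ x v * ht +
    m ^ 2 * (1 - m) * hf' - m ^ 2 * cov θ x v * hf

/-! ### Nonnegative weights and degenerate variables -/

theorem bern_nonneg {t : ℝ} (h : t ∈ Set.Icc (0 : ℝ) 1) (a : Bool) : 0 ≤ bern t a := by
  obtain ⟨h0, h1⟩ := h
  cases a <;> simp [bern] <;> linarith

theorem joint_nonneg {θ : Param T r} (hθ : θ ∈ paramSpace T r) (α : V → Bool) : 0 ≤ joint θ α :=
  mul_nonneg (bern_nonneg hθ.1 _) (Finset.prod_nonneg fun e _ => bern_nonneg (hθ.2 e _) _)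

theorem expectAll_mul_ind_eq_zero {θ : Param T r} (hθ : θ ∈ paramSpace T r) {v : V} {b : Bool}
    (h : expectAll θ (ind v b) = 0) (f : (V → Bool) → ℝ) :
    expectAll θ (fun α => f α * ind v b α) = 0 := by
  classical
  unfold expectAll at h ⊢
  rw [Finset.sum_eq_zero_iff_of_nonneg fun α _ => mul_nonneg (joint_nonneg hθ α)
    (by unfold ind; split_ifs <;> norm_num)] at h
  refine Finset.sum_eq_zero fun α hα => ?_
  have := h α hα
  linear_combination f α * this

/-- Here `cov_mul_of_separates` says nothing. Instead `Y_v` is almost surely constant: by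
nonnegativity the null value contributes nothing, and conditioning on the other value is no
conditioning at all. -/
theorem cov_eq_zero_of_cov_self_eq_zero (hT : T.IsTree) {θ : Param T r} (hθ : θ ∈ paramSpace T r)
    {v x y : V} (h : NodeSeparates T v x y) (hv : cov θ v v = 0) : cov θ x y = 0 := by
  have hb := expectAll_condIndep θ (B := {y}) (by simpa using h) (dependsOnlyOn_centred θ x)
    (dependsOnlyOn_centred θ y)
  have ht := hb true
  have hf := hb false
  rw [expectAll_ind_true, expectAll_centred_mul_ind hT, expectAll_centred_mul_ind hT] at ht
  rw [expectAll_ind_false hT, expectAll_centred_mul_ind_false hT,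
    expectAll_centred_mul_ind_false hT] at hf
  have hs := expectAll_split θ v fun α => centred θ x α * centred θ y α
  rw [cov, ← hs]
  rw [cov_self hT] at hv
  rcases mul_eq_zero.1 hv with h0 | h1
  · have hz := fun f => expectAll_mul_ind_eq_zero hθ ((expectAll_ind_true θ v).trans h0) f
    have hx := hz (centred θ x)
    rw [expectAll_centred_mul_ind hT] at hx
    rw [h0, hx] at hf
    rw [hz]
    linarith
  · have hz := fun f => expectAll_mul_ind_eq_zero hθ ((expectAll_ind_false hT θ v).trans h1) f
    have hx := hz (centred θ x)
    rw [expectAll_centred_mul_ind_false hT] at hx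
    have h1' : meanAt θ v = 1 := by linarith
    have hx' : cov θ x v = 0 := by linarith
    rw [h1', hx'] at ht
    rw [hz]
    linarith

/-! ### Parameters from moments -/

theorem expectAll_mul_val_arc (hT : T.IsTree) (θ : Param T r) (e : Arc T r)
    {f : (V → Bool) → ℝ} (hf : DependsOnlyOn {e.1.1} f) :
    expectAll θ (fun α => f α * val (α e.1.2)) =
      expectAll θ fun α => f α * θ.cond e (α e.1.1) := by
  rw [expectAll_eq_sum_netWeight hT, expectAll_eq_sum_netWeight hT,
    sum_netWeight_mul_val (dependsOnlyOn_successProb θ)]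
  · simp only [successProb_arc hT]
  · refine hf.mono ?_
    rintro y (rfl : y = e.1.1)
    have := e.2.2
    simp only [Set.mem_ofPred_eq]
    omega

theorem meanAt_root (hT : T.IsTree) (θ : Param T r) : meanAt θ r = θ.root := by
  have := sum_netWeight_mul_val (dependsOnlyOn_successProb θ) r (f := fun _ => 1)
    (fun _ _ _ => rfl)
  simp only [one_mul, successProb_root] at this
  rw [← expectAll_eq_sum_netWeight hT, ← expectAll_eq_sum_netWeight hT, expectAll_const hT] at this
  exact this

theorem meanAt_arc (hT : T.IsTree) (θ : Param T r) (e : Arc T r) :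
    meanAt θ e.1.2 = θ.cond e false + eta θ e * meanAt θ e.1.1 := by
  have h := expectAll_mul_val_arc hT θ e (f := fun _ => 1) (fun _ _ _ => rfl)
  have h' := expectAll_add θ (fun _ => θ.cond e false) fun α => eta θ e * val (α e.1.1)
  rw [expectAll_const hT, expectAll_const_mul] at h'
  simp only [one_mul] at h
  rw [meanAt, h, meanAt, ← h']
  refine congrArg _ (funext fun α => ?_)
  cases hα : α e.1.1 <;> simp [val, eta]

/-- The conditional mean of the head is affine in the binary state of the tail, with slope `eta`. -/
theorem eta_mul_cov_self (hT : T.IsTree) (θ : Param T r) (e : Arc T r) :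
    eta θ e * cov θ e.1.1 e.1.1 = cov θ e.1.1 e.1.2 := by
  have h := expectAll_mul_val_arc hT θ e (dependsOnlyOn_centred θ e.1.1)
  have h1 := expectAll_add θ (fun α => θ.cond e false * centred θ e.1.1 α)
    fun α => eta θ e * (centred θ e.1.1 α * ind e.1.1 true α)
  rw [expectAll_const_mul, expectAll_const_mul, expectAll_centred hT,
    expectAll_centred_mul_ind hT, mul_zero, zero_add] at h1
  rw [← expectAll_centred_mul_ind hT θ _ e.1.2, ← h1]
  refine Eq.trans (congrArg _ (funext fun α => ?_)) h.symm
  cases hα : α e.1.1 <;> simp [ind, eta, hα] <;> ring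

/-! ### The observed moments -/

theorem expect_leafDist (θ : Param T r) (f : (Leaf T → Bool) → ℝ) :
    expect (leafDist θ) f = expectAll θ fun α => f fun i => α i := by
  classical
  unfold expect leafDist expectAll
  have := Finset.sum_fiberwise (Finset.univ : Finset (V → Bool))
    (fun α => fun i : Leaf T => α i) fun α => joint θ α * f fun i => α i
  rw [← this]
  refine Finset.sum_congr rfl fun β _ => ?_
  rw [Finset.sum_mul]
  refine Finset.sum_congr ?_ fun α hα => ?_
  · ext α
    simp [funext_iff]
  · rw [Finset.mem_filter] at hα
    rw [← hα.2]

theorem mean_leafDist (θ : Param T r) (i : Leaf T) : mean (leafDist θ) i = meanAt θ i :=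
  expect_leafDist θ _

theorem mom₂_leafDist (θ : Param T r) (i j : Leaf T) : mom₂ (leafDist θ) i j = cov θ i j := by
  rw [mom₂, expect_leafDist, mean_leafDist, mean_leafDist]
  rfl

theorem mom₃_leafDist (θ : Param T r) (i j k : Leaf T) :
    mom₃ (leafDist θ) i j k = cov₃ θ i j k := by
  rw [mom₃, expect_leafDist, mean_leafDist, mean_leafDist, mean_leafDist]
  rfl

end Moments

/-! ### Isolated edges -/

section Isolated

variable {V : Type*} [Fintype V] {T : SimpleGraph V} {r : V} {p : (Leaf T → Bool) → ℝ}

theorem mom₂_comm (p : (Leaf T → Bool) → ℝ) (i j : Leaf T) : mom₂ p i j = mom₂ p j i := by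
  simp only [mom₂, mul_comm]

theorem forest_le (p : (Leaf T → Bool) → ℝ) : forest p ≤ T := SimpleGraph.deleteEdges_le _

theorem forest_adj {u v : V} :
    (forest p).Adj u v ↔ T.Adj u v ∧ ¬ Isolated p s(u, v) := by
  simp [forest, SimpleGraph.deleteEdges_adj]

/-- The correlated leaves are named so that `i` is on the side of `u` and `j` on that of `v`. -/
theorem exists_leaves_of_not_isolated (hT : T.IsTree) {u v : V} (h : T.Adj u v)
    (hn : ¬ Isolated p s(u, v)) :
    ∃ i j : Leaf T, mom₂ p i j ≠ 0 ∧ NodeSeparates T u i j ∧ NodeSeparates T v i j ∧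
      NodeSeparates T u i v ∧ NodeSeparates T v u j := by
  simp only [Isolated, not_forall] at hn
  obtain ⟨i, j, ⟨w, hw, he⟩, hij⟩ := hn
  have hu := nodeSeparates_of_isPath hT.isAcyclic hw (w.fst_mem_support_of_mem_edges he)
  have hv := nodeSeparates_of_isPath hT.isAcyclic hw (w.snd_mem_support_of_mem_edges he)
  have hn := not_joinedOff_and_joinedOff hT.isAcyclic (x := (i : V)) h
  simp only [nodeSeparates_iff hT.connected] at *
  rcases joinedOff_or_joinedOff hT.connected h.ne i with h1 | h1
  · refine ⟨j, i, by rwa [mom₂_comm], fun h => hu h.symm, fun h => hv h.symm,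
      fun h => hu (h1.trans h.symm), fun h' => hn ⟨h1, h'.symm⟩⟩
  · exact ⟨i, j, hij, hu, hv, fun h' => hn ⟨h', h1⟩, fun h => hv (h1.trans h)⟩

variable (T p) in
/-- The standing assumptions on the tree and the leaf distribution. -/
structure Admissible : Prop where
  isTree : T.IsTree
  nondegenerate : ∀ i : Leaf T, mean p i * (1 - mean p i) ≠ 0
  three_le_deg : ∀ v, IsInner T v → 3 ≤ deg (forest p) v

variable {θ : Param T r}

theorem mean_of_fiber (hθ : θ ∈ fiber T r p) (i : Leaf T) : mean p i = meanAt θ i := by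
  rw [← hθ.2, mean_leafDist]

theorem mom₂_of_fiber (hθ : θ ∈ fiber T r p) (i j : Leaf T) : mom₂ p i j = cov θ i j := by
  rw [← hθ.2, mom₂_leafDist]

theorem mom₃_of_fiber (hθ : θ ∈ fiber T r p) (i j k : Leaf T) :
    mom₃ p i j k = cov₃ θ i j k := by
  rw [← hθ.2, mom₃_leafDist]

/-- An inner node lies between the correlated leaves provided by a non-isolated edge at it, which is
impossible for a constant variable. -/
theorem cov_self_ne_zero (h : Admissible T p) (hθ : θ ∈ fiber T r p) (v : V) :
    cov θ v v ≠ 0 := by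
  by_cases hv : IsLeaf T v
  · rw [cov_self h.isTree]
    have := h.nondegenerate ⟨v, hv⟩
    rwa [mean_of_fiber hθ] at this
  · obtain ⟨a, -, -, ha, -⟩ := exists_three_adj (h.three_le_deg v hv)
    rw [forest_adj] at ha
    obtain ⟨i, j, hij, hu, -⟩ := exists_leaves_of_not_isolated h.isTree ha.1 ha.2
    rw [mom₂_of_fiber hθ] at hij
    exact fun h0 => hij (cov_eq_zero_of_cov_self_eq_zero h.isTree hθ.1 hu h0)

theorem cov_ne_zero_of_separates (h : Admissible T p) (hθ : θ ∈ fiber T r p) {v x y : V}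
    (hv : NodeSeparates T v x y) : cov θ x y ≠ 0 ↔ cov θ x v ≠ 0 ∧ cov θ v y ≠ 0 := by
  rw [← mul_ne_zero_iff, ← cov_mul_of_separates h.isTree θ hv, mul_ne_zero_iff]
  simp [cov_self_ne_zero h hθ]

theorem cov_ne_zero_of_adj (h : Admissible T p) (hθ : θ ∈ fiber T r p) {u v : V}
    (huv : (forest p).Adj u v) : cov θ u v ≠ 0 := by
  rw [forest_adj] at huv
  obtain ⟨i, j, hij, hu, -, -, hv⟩ := exists_leaves_of_not_isolated h.isTree huv.1 huv.2
  rw [mom₂_of_fiber hθ] at hij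
  exact ((cov_ne_zero_of_separates h hθ hv).1
    ((cov_ne_zero_of_separates h hθ hu).1 hij).2).1

theorem cov_ne_zero_of_reachable (h : Admissible T p) (hθ : θ ∈ fiber T r p) {x y : V}
    (hxy : (forest p).Reachable x y) : cov θ x y ≠ 0 := by
  obtain ⟨w, hw⟩ := hxy.exists_isPath
  induction w with
  | nil => exact cov_self_ne_zero h hθ _
  | @cons x a y hxa w ih =>
    have hsep : NodeSeparates T a x y :=
      nodeSeparates_of_isPath h.isTree.isAcyclic (hw.mapLe (forest_le p)) (by simp)
    exact (cov_ne_zero_of_separates h hθ hsep).2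
      ⟨cov_ne_zero_of_adj h hθ hxa, ih w.reachable hw.of_cons⟩

theorem exists_leaf_behind (h : Admissible T p) {u v : V} (huv : T.Adj u v) :
    ∃ b : Leaf T, (forest p).Reachable v b ∧ NodeSeparates T v u b :=
  exists_leaf_beyond h.isTree (forest_le p) h.three_le_deg huv

/-- Forest paths lead from `u` and `v` to leaves `a` and `b` on opposite sides of the edge. The
leaves are uncorrelated, while the covariances of `a` with `u` and of `v` with `b` are nonzero, so
the edge must carry the zero. -/
theorem cov_eq_zero_of_isolated (h : Admissible T p) (hθ : θ ∈ fiber T r p) {u v : V}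
    (huv : T.Adj u v) (hi : Isolated p s(u, v)) : cov θ u v = 0 := by
  obtain ⟨b, hb, hvb⟩ := exists_leaf_behind h huv
  obtain ⟨a, ha, hua⟩ := exists_leaf_behind h huv.symm
  have hsep := edgeSeparates_of_nodeSeparates h.isTree huv hua hvb
  obtain ⟨w, hw⟩ := hsep.1.exists_isPath
  have h0 := hi a b ⟨w, hw, hsep.2 w⟩
  rw [mom₂_of_fiber hθ] at h0
  have hu : NodeSeparates T u a b :=
    nodeSeparates_of_isPath h.isTree.isAcyclic hw (w.fst_mem_support_of_mem_edges (hsep.2 w))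
  by_contra hne
  refine (cov_ne_zero_of_separates h hθ hu).2 ⟨?_, ?_⟩ h0
  · exact cov_ne_zero_of_reachable h hθ ha.symm
  · exact (cov_ne_zero_of_separates h hθ hvb).2 ⟨hne, cov_ne_zero_of_reachable h hθ hb⟩

/-- Two distinct edges at `x` make `x` inner, and a third edge at `x` in the forest contradicts the
demand that all other common neighbours of the two be isolated. -/
theorem edgeRel_eq (h : Admissible T p) {e e' : Sym2 V} (hee : EdgeRel p e e') : e = e' := by
  obtain ⟨he, he', hiff, heq | ⟨⟨x, hx, hx'⟩, hall⟩⟩ := hee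
  · exact heq
  obtain ⟨y, rfl⟩ := Sym2.mem_iff_exists.1 hx
  obtain ⟨z, rfl⟩ := Sym2.mem_iff_exists.1 hx'
  rw [SimpleGraph.mem_edgeSet] at he he'
  by_contra hne
  have hyz : y ≠ z := fun h => hne (by rw [h])
  have hin : IsInner T x := by
    classical
    intro hl
    unfold IsLeaf deg at hl
    rw [← SimpleGraph.card_neighborFinset_eq_degree, Finset.card_eq_one] at hl
    obtain ⟨a, ha⟩ := hl
    have h1 : y ∈ T.neighborFinset x := by simpa using he
    have h2 : z ∈ T.neighborFinset x := by simpa using he'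
    rw [ha, Finset.mem_singleton] at h1 h2
    exact hyz (h1.trans h2.symm)
  obtain ⟨a, ha, hay, haz⟩ := exists_adj_ne (h.three_le_deg x hin) y z
  rw [forest_adj] at ha
  refine ha.2 (hall s(x, a) ha.1 ?_ ?_ ⟨x, by simp, by simp⟩ ⟨x, by simp, by simp⟩)
  · exact fun h' => hay (Sym2.congr_right.1 h')
  · exact fun h' => haz (Sym2.congr_right.1 h')

theorem edgeClass_eq (h : Admissible T p) {e : Sym2 V} (he : e ∈ T.edgeSet) :
    edgeClass p e = {e} := by
  ext e'
  simp only [edgeClass, Set.mem_ofPred_eq, Set.mem_singleton_iff]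
  constructor
  · intro ht
    induction ht with
    | single h' => exact (edgeRel_eq h h').symm
    | tail _ h' ih => exact (edgeRel_eq h h').symm.trans ih
  · rintro rfl
    exact .single ⟨he, he, Iff.rfl, .inl rfl⟩

end Isolated

/-! ### Formulas for the parameters -/

section Formulas

variable {V : Type*} [Fintype V] {T : SimpleGraph V} {r : V} {p : (Leaf T → Bool) → ℝ}
  {θ : Param T r}

theorem muBar_sq_add (hT : T.IsTree) (θ : Param T r) (v : V) :
    muBar θ v ^ 2 + 4 * cov θ v v = 1 := by
  rw [muBar_eq, cov_self hT]
  ring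

theorem disc_mul (hT : T.IsTree) (hθ : θ ∈ fiber T r p) {v : V} {i j k : Leaf T}
    (hs : NodeSeparates₃ T v i j k) :
    disc p i j k * cov θ v v ^ 4 = (cov θ i v * cov θ j v * cov θ k v) ^ 2 := by
  have h3 := cov₃_mul_of_separates hT θ hs
  have hij := cov_mul_of_separates hT θ hs.1
  have hik := cov_mul_of_separates hT θ hs.2.1
  have hjk := cov_mul_of_separates hT θ hs.2.2
  rw [cov_comm θ v j] at hij
  rw [cov_comm θ v k] at hik hjk
  have hm := muBar_sq_add hT θ v
  rw [disc, mom₃_of_fiber hθ, mom₂_of_fiber hθ, mom₂_of_fiber hθ, mom₂_of_fiber hθ]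
  set U := cov θ v v
  set x := cov θ i v
  set y := cov θ j v
  set z := cov θ k v
  have e1 : cov₃ θ i j k ^ 2 * U ^ 4 = (x * y * z * muBar θ v) ^ 2 := by
    rw [← h3]
    ring
  have e2 : cov θ i j * cov θ i k * cov θ j k * U ^ 3 = (x * y) * (x * z) * (y * z) := by
    rw [← hij, ← hik, ← hjk]
    ring
  linear_combination e1 + 4 * U * e2 + (x * y * z) ^ 2 * hm

theorem nodeSeparates₃_cov_ne_zero (h : Admissible T p) (hθ : θ ∈ fiber T r p) {v : V}
    {i j k : Leaf T} (hs : NodeSeparates₃ T v i j k)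
    (hne : mom₂ p i j * mom₂ p i k * mom₂ p j k ≠ 0) :
    cov θ i v ≠ 0 ∧ cov θ j v ≠ 0 ∧ cov θ k v ≠ 0 := by
  rw [mom₂_of_fiber hθ, mom₂_of_fiber hθ, mom₂_of_fiber hθ, mul_ne_zero_iff,
    mul_ne_zero_iff] at hne
  have h1 := (cov_ne_zero_of_separates h hθ hs.1).1 hne.1.1
  have h2 := (cov_ne_zero_of_separates h hθ hs.2.1).1 hne.1.2
  rw [cov_comm θ v] at h1 h2
  exact ⟨h1.1, h1.2, h2.2⟩

theorem disc_ne_zero (h : Admissible T p) (hθ : θ ∈ fiber T r p) {v : V} {i j k : Leaf T}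
    (hs : NodeSeparates₃ T v i j k) (hi : cov θ i v ≠ 0) (hj : cov θ j v ≠ 0)
    (hk : cov θ k v ≠ 0) : disc p i j k ≠ 0 := by
  have := disc_mul h.isTree hθ hs
  intro h0
  rw [h0, zero_mul] at this
  exact pow_ne_zero 2 (mul_ne_zero (mul_ne_zero hi hj) hk) this.symm

theorem muBar_sq_eq (h : Admissible T p) (hθ : θ ∈ fiber T r p) {v : V} {i j k : Leaf T}
    (hs : NodeSeparates₃ T v i j k)
    (hne : mom₂ p i j * mom₂ p i k * mom₂ p j k ≠ 0) :
    muBar θ v ^ 2 = mom₃ p i j k ^ 2 / disc p i j k := by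
  obtain ⟨hi, hj, hk⟩ := nodeSeparates₃_cov_ne_zero h hθ hs hne
  rw [eq_div_iff (disc_ne_zero h hθ hs hi hj hk)]
  have h3 := cov₃_mul_of_separates h.isTree θ hs
  have hd := disc_mul h.isTree hθ hs
  rw [← mom₃_of_fiber hθ] at h3
  have hU := pow_ne_zero 4 (cov_self_ne_zero h hθ v)
  refine mul_right_cancel₀ hU ?_
  linear_combination muBar θ v ^ 2 * hd -
    (mom₃ p i j k * cov θ v v ^ 2 + cov θ i v * cov θ j v * cov θ k v * muBar θ v) * h3

theorem exists_separated_triple (h : Admissible T p) (hθ : θ ∈ fiber T r p) {v : V}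
    (hv : IsInner T v) : ∃ i j k : Leaf T, NodeSeparates₃ T v i j k ∧
      mom₂ p i j * mom₂ p i k * mom₂ p j k ≠ 0 := by
  obtain ⟨a, b, c, ha, hb, hc, hab, hac, hbc⟩ := exists_three_adj (h.three_le_deg v hv)
  have hT := h.isTree
  have ha' := forest_le p ha
  have hb' := forest_le p hb
  have hc' := forest_le p hc
  obtain ⟨i, hi, hi'⟩ := exists_leaf_behind h ha'
  obtain ⟨j, hj, hj'⟩ := exists_leaf_behind h hb'
  obtain ⟨k, hk, hk'⟩ := exists_leaf_behind h hc'
  replace hi := ha.reachable.trans hi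
  replace hj := hb.reachable.trans hj
  replace hk := hc.reachable.trans hk
  refine ⟨i, j, k, ⟨nodeSeparates_of_branches hT ha' hb' hab hi' hj',
    nodeSeparates_of_branches hT ha' hc' hac hi' hk',
    nodeSeparates_of_branches hT hb' hc' hbc hj' hk'⟩, ?_⟩
  rw [mom₂_of_fiber hθ, mom₂_of_fiber hθ, mom₂_of_fiber hθ]
  exact mul_ne_zero (mul_ne_zero (cov_ne_zero_of_reachable h hθ (hi.symm.trans hj))
    (cov_ne_zero_of_reachable h hθ (hi.symm.trans hk)))
    (cov_ne_zero_of_reachable h hθ (hj.symm.trans hk))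

theorem eta_eq_div (h : Admissible T p) (hθ : θ ∈ fiber T r p) (e : Arc T r) :
    eta θ e = cov θ e.1.1 e.1.2 / cov θ e.1.1 e.1.1 := by
  rw [eq_div_iff (cov_self_ne_zero h hθ _), eta_mul_cov_self h.isTree]

theorem exists_separated_pair (h : Admissible T p) (hθ : θ ∈ fiber T r p) {v : V} {i : Leaf T}
    (hv : IsInner T v) (hvi : T.Adj v i) :
    ∃ j k : Leaf T, NodeSeparates₃ T v i j k ∧ mom₂ p j k ≠ 0 := by
  have hT := h.isTree
  obtain ⟨a, ha, hai, -⟩ := exists_adj_ne (h.three_le_deg v hv) i i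
  obtain ⟨b, hb, hbi, hba⟩ := exists_adj_ne (h.three_le_deg v hv) i a
  have ha' := forest_le p ha
  have hb' := forest_le p hb
  obtain ⟨j, hj, hj'⟩ := exists_leaf_behind h ha'
  obtain ⟨k, hk, hk'⟩ := exists_leaf_behind h hb'
  replace hj := ha.reachable.trans hj
  replace hk := hb.reachable.trans hk
  have hi' : NodeSeparates T (i : V) v i := nodeSeparates_comm (nodeSeparates_left hT.connected _ _)
  refine ⟨j, k, ⟨nodeSeparates_of_branches hT hvi ha' hai.symm hi' hj',
    nodeSeparates_of_branches hT hvi hb' hbi.symm hi' hk',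
    nodeSeparates_of_branches hT ha' hb' hba.symm hj' hk'⟩, ?_⟩
  rw [mom₂_of_fiber hθ]
  exact cov_ne_zero_of_reachable h hθ (hj.symm.trans hk)

/-- In `disc_mul` the covariances of `j` and `k` with the tail combine to `mom₂ p j k` times the
variance; what is left is the square of `cov i v / cov v v`. -/
theorem eta_sq_terminal (h : Admissible T p) (hθ : θ ∈ fiber T r p) {e : Arc T r} {i j k : Leaf T}
    (he : e.1.2 = i) (hs : NodeSeparates₃ T e.1.1 i j k) (hjk : mom₂ p j k ≠ 0) :
    eta θ e ^ 2 = disc p i j k / mom₂ p j k ^ 2 := by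
  rw [eta_eq_div h hθ, he, eq_div_iff (pow_ne_zero 2 hjk), mom₂_of_fiber hθ]
  have hd := disc_mul h.isTree hθ hs
  have h1 := cov_mul_of_separates h.isTree θ hs.2.2
  have hU := cov_self_ne_zero h hθ e.1.1
  rw [cov_comm θ e.1.1 k] at h1
  rw [cov_comm θ e.1.1 i]
  generalize cov θ e.1.1 e.1.1 = U at *
  rw [div_pow, div_mul_eq_mul_div, div_eq_iff (pow_ne_zero 2 hU)]
  refine mul_right_cancel₀ (pow_ne_zero 2 hU) ?_
  linear_combination cov θ i e.1.1 ^ 2 *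
    (cov θ j k * U + cov θ j e.1.1 * cov θ k e.1.1) * h1 - hd

theorem exists_separated_quadruple (h : Admissible T p) {u v : V} (hu : IsInner T u)
    (hv : IsInner T v) (huv : (forest p).Adj u v) :
    ∃ i j k l : Leaf T,
      NodeSeparates (forest p) u i j ∧ NodeSeparates (forest p) v k l ∧
      EdgeSeparates (forest p) s(u, v) i k ∧ EdgeSeparates (forest p) s(u, v) i l ∧
      EdgeSeparates (forest p) s(u, v) j k ∧ EdgeSeparates (forest p) s(u, v) j l := by
  have hT := h.isTree
  have hF := forest_le p
  have key : ∀ {u v : V}, IsInner T u → (forest p).Adj u v → ∃ i j : Leaf T,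
      NodeSeparates T u i j ∧ (forest p).Reachable u i ∧ (forest p).Reachable u j ∧
      NodeSeparates T u v i ∧ NodeSeparates T u v j := by
    intro u v hu huv
    obtain ⟨a, ha, hav, -⟩ := exists_adj_ne (h.three_le_deg u hu) v v
    obtain ⟨b, hb, hbv, hba⟩ := exists_adj_ne (h.three_le_deg u hu) v a
    obtain ⟨i, hi, hi'⟩ := exists_leaf_behind h (hF ha)
    obtain ⟨j, hj, hj'⟩ := exists_leaf_behind h (hF hb)
    have hvv : NodeSeparates T v u v := nodeSeparates_comm (nodeSeparates_left hT.connected _ _)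
    exact ⟨i, j, nodeSeparates_of_branches hT (hF ha) (hF hb) hba.symm hi' hj',
      ha.reachable.trans hi, hb.reachable.trans hj,
      nodeSeparates_of_branches hT (hF huv) (hF ha) hav.symm hvv hi',
      nodeSeparates_of_branches hT (hF huv) (hF hb) hbv.symm hvv hj'⟩
  obtain ⟨i, j, hij, hi, hj, hi', hj'⟩ := key hu huv
  obtain ⟨k, l, hkl, hk, hl, hk', hl'⟩ := key hv huv.symm
  have hE : ∀ {x y : Leaf T}, (forest p).Reachable u x → (forest p).Reachable v y →
      NodeSeparates T u v x → NodeSeparates T v u y → EdgeSeparates (forest p) s(u, v) x y := by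
    intro x y hx hy hx' hy'
    refine ⟨hx.symm.trans (huv.reachable.trans hy), fun w => ?_⟩
    simpa using (edgeSeparates_of_nodeSeparates hT (hF huv) hx' hy').2 (w.mapLe hF)
  exact ⟨i, j, k, l, nodeSeparates_of_ge hF hij (hi.symm.trans hj),
    nodeSeparates_of_ge hF hkl (hk.symm.trans hl), hE hi hk hi' hk', hE hi hl hi' hl',
    hE hj hk hj' hk', hE hj hl hj' hl'⟩

theorem eta_sq_inner (h : Admissible T p) (hθ : θ ∈ fiber T r p) {e : Arc T r}
    {i j k l : Leaf T}
    (hij : NodeSeparates (forest p) e.1.1 i j) (hkl : NodeSeparates (forest p) e.1.2 k l)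
    (hik : EdgeSeparates (forest p) e.edge i k) (hil : EdgeSeparates (forest p) e.edge i l)
    (hjk : EdgeSeparates (forest p) e.edge j k) :
    mom₂ p i j ≠ 0 ∧ disc p i k l ≠ 0 ∧
      eta θ e ^ 2 = mom₂ p i l ^ 2 / mom₂ p i j ^ 2 * (disc p i j k / disc p i k l) := by
  have hT := h.isTree
  have hF := forest_le p
  have nij := cov_ne_zero_of_reachable h hθ hij.1
  have nkl := cov_ne_zero_of_reachable h hθ hkl.1
  have nik := cov_ne_zero_of_reachable h hθ hik.1
  rw [eta_eq_div h hθ]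
  obtain ⟨⟨u, v⟩, huv, hd⟩ := e
  simp only [Arc.edge] at *
  replace hij := nodeSeparates_of_le hT.isAcyclic hF hij
  replace hkl := nodeSeparates_of_le hT.isAcyclic hF hkl
  obtain ⟨uik, vik⟩ := nodeSeparates_of_edgeSeparates hT.isAcyclic hF hik
  obtain ⟨uil, vil⟩ := nodeSeparates_of_edgeSeparates hT.isAcyclic hF hil
  obtain ⟨ujk, vjk⟩ := nodeSeparates_of_edgeSeparates hT.isAcyclic hF hjk
  have hnv : ∀ {x y w : V}, NodeSeparates T w x y → ∀ z, JoinedOff T w x z → ¬ JoinedOff T w y z :=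
    fun hs z h1 h2 => (nodeSeparates_iff hT.connected).1 hs (h1.trans h2.symm)
  have hside := fun x => joinedOff_or_joinedOff hT.connected huv.ne x
  -- If `i` were on the side of `v`, both `k` and `l` would be on the side of `u`, and `v` could not
  -- separate them.
  have ui : ¬ JoinedOff T u i v := fun hi =>
    hnv hkl u ((hside k).resolve_left (hnv uik v hi)) ((hside l).resolve_left (hnv uil v hi))
  have vi : JoinedOff T v i u := (hside i).resolve_left ui
  have vk : ¬ JoinedOff T v k u := hnv vik u vi
  have vl : ¬ JoinedOff T v l u := hnv vil u vi
  have suiv : NodeSeparates T u i v := (nodeSeparates_iff hT.connected).2 ui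
  have svku : NodeSeparates T v k u := (nodeSeparates_iff hT.connected).2 vk
  have svlu : NodeSeparates T v l u := (nodeSeparates_iff hT.connected).2 vl
  have c1 := cov_mul_of_separates hT θ hij
  have c2 := cov_mul_of_separates hT θ uil
  have c3 := cov_mul_of_separates hT θ svlu
  have c4 := cov_mul_of_separates hT θ svku
  have c5 := cov_mul_of_separates hT θ suiv
  have d1 := disc_mul hT hθ (v := u) (i := i) (j := j) (k := k) ⟨hij, uik, ujk⟩
  have d2 := disc_mul hT hθ (v := v) (i := i) (j := k) (k := l) ⟨vik, vil, hkl⟩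
  have n1 := (cov_ne_zero_of_separates h hθ hij).1 nij
  have n2 := (cov_ne_zero_of_separates h hθ vik).1 nik
  have n3 := (cov_ne_zero_of_separates h hθ hkl).1 nkl
  have hU := cov_self_ne_zero h hθ u
  have hV := cov_self_ne_zero h hθ v
  rw [cov_comm θ v l] at n3
  have hD := disc_ne_zero h hθ (v := v) (i := i) (j := k) (k := l) ⟨vik, vil, hkl⟩ n2.1 n3.1 n3.2
  have hij' : mom₂ p i j ≠ 0 := by rwa [mom₂_of_fiber hθ]
  refine ⟨hij', hD, ?_⟩
  rw [mom₂_of_fiber hθ, mom₂_of_fiber hθ]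
  rw [cov_comm θ u j] at c1 n1
  rw [cov_comm θ u l] at c2
  rw [cov_comm θ v u] at c3 c4
  have n4 : cov θ u v ≠ 0 := by
    intro h0
    rw [h0, mul_zero] at c5
    exact (mul_ne_zero n2.1 hU) c5
  obtain ⟨na, nb⟩ := n1
  obtain ⟨nc, nd⟩ := n3
  -- All quantities are expressed through the covariances of `i`, `j` with `u`, of `k`, `l` with
  -- `v`, of `u` with `v`, and the two variances; the leaf covariances then cancel.
  have e1 : cov θ i j = cov θ i u * cov θ j u / cov θ u u := by rw [eq_div_iff hU, c1]
  have e2 : cov θ l u = cov θ l v * cov θ u v / cov θ v v := by rw [eq_div_iff hV, c3]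
  have e3 : cov θ i l = cov θ i u * cov θ l u / cov θ u u := by rw [eq_div_iff hU, c2]
  have e4 : cov θ k u = cov θ k v * cov θ u v / cov θ v v := by rw [eq_div_iff hV, c4]
  have e5 : cov θ i v = cov θ i u * cov θ u v / cov θ u u := by rw [eq_div_iff hU, c5]
  have e6 : disc p i j k = (cov θ i u * cov θ j u * cov θ k u) ^ 2 / cov θ u u ^ 4 := by
    rw [eq_div_iff (pow_ne_zero 4 hU), d1]
  have e7 : disc p i k l = (cov θ i v * cov θ k v * cov θ l v) ^ 2 / cov θ v v ^ 4 := by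
    rw [eq_div_iff (pow_ne_zero 4 hV), d2]
  rw [e6, e7, e5, e4, e3, e2, e1]
  field_simp

end Formulas

/-! ### Switching labels -/

section Switch

variable {V : Type*}

open Classical in
/-- The state obtained by exchanging the labels at the nodes in `S`. -/
noncomputable def flipOn (S : Set V) (α : V → Bool) (x : V) : Bool := if x ∈ S then !α x else α x

theorem flipOn_involutive (S : Set V) : Function.Involutive (flipOn S) := by
  intro α
  ext x
  by_cases h : x ∈ S <;> simp [flipOn, h]

theorem bern_one_sub (t : ℝ) (a : Bool) : bern (1 - t) a = bern t (!a) := by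
  cases a <;> simp [bern]

open Classical in
theorem val_flipOn (S : Set V) (α : V → Bool) (x : V) :
    val (flipOn S α x) = if x ∈ S then 1 - val (α x) else val (α x) := by
  by_cases h : x ∈ S <;> cases hα : α x <;> simp [flipOn, h, val, hα]

theorem switch_mem_paramSpace {T : SimpleGraph V} {r : V} {θ : Param T r} (hθ : θ ∈ paramSpace T r) (S : Set V) :
    switch S θ ∈ paramSpace T r := by
  have h1 : ∀ {t : ℝ}, t ∈ Set.Icc (0 : ℝ) 1 → 1 - t ∈ Set.Icc (0 : ℝ) 1 :=
    fun h => ⟨by linarith [h.2], by linarith [h.1]⟩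
  refine ⟨?_, fun e b => ?_⟩
  · simp only [switch]
    split_ifs
    · exact h1 hθ.1
    · exact hθ.1
  · simp only [switch]
    split_ifs
    · exact h1 (hθ.2 _ _)
    · exact h1 (hθ.2 _ _)
    · exact hθ.2 _ _
    · exact hθ.2 _ _

variable [Fintype V] {T : SimpleGraph V} {r : V}

theorem joint_switch (θ : Param T r) (S : Set V) (α : V → Bool) :
    joint (switch S θ) (flipOn S α) = joint θ α := by
  classical
  have key : ∀ (t : ℝ) (x : V), bern (if x ∈ S then 1 - t else t) (flipOn S α x) = bern t (α x) := by
    intro t x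
    by_cases h : x ∈ S <;> simp [flipOn, h, bern_one_sub]
  unfold joint switch
  simp only [key]
  congr 1
  refine Finset.prod_congr rfl fun e _ => ?_
  by_cases h : e.1.1 ∈ S <;> simp [flipOn, h]

theorem expectAll_switch (θ : Param T r) (S : Set V) (f : (V → Bool) → ℝ) :
    expectAll (switch S θ) f = expectAll θ fun α => f (flipOn S α) := by
  classical
  unfold expectAll
  rw [← Equiv.sum_comp (flipOn_involutive S).toPerm]
  exact Finset.sum_congr rfl fun α _ => by
    rw [Function.Involutive.coe_toPerm, joint_switch]

theorem leafDist_switch (θ : Param T r) {S : Set V} (hS : ∀ v ∈ S, IsInner T v) :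
    leafDist (switch S θ) = leafDist θ := by
  classical
  funext β
  have key : ∀ θ : Param T r, leafDist θ β =
      expectAll θ fun α => if ∀ i : Leaf T, α i = β i then 1 else 0 := by
    intro θ
    simp [leafDist, expectAll, Finset.sum_filter]
  rw [key, key, expectAll_switch]
  have hl : ∀ (α : V → Bool) (i : Leaf T), flipOn S α i = α i :=
    fun α i => if_neg fun h => hS i h i.2
  simp only [hl]

theorem switch_mem_fiber {p : (Leaf T → Bool) → ℝ} {θ : Param T r} (hθ : θ ∈ fiber T r p)
    {S : Set V} (hS : ∀ v ∈ S, IsInner T v) : switch S θ ∈ fiber T r p :=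
  ⟨switch_mem_paramSpace hθ.1 S, (leafDist_switch θ hS).trans hθ.2⟩

open Classical in
theorem meanAt_switch (hT : T.IsTree) (θ : Param T r) (S : Set V) (x : V) :
    meanAt (switch S θ) x = if x ∈ S then 1 - meanAt θ x else meanAt θ x := by
  rw [meanAt, expectAll_switch]
  simp only [val_flipOn]
  split_ifs
  · rw [expectAll_sub, expectAll_const hT, meanAt]
  · rfl

open Classical in
theorem cov_switch (hT : T.IsTree) (θ : Param T r) (S : Set V) (x y : V) :
    cov (switch S θ) x y =
      (if x ∈ S then -1 else 1) * (if y ∈ S then -1 else 1) * cov θ x y := by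
  rw [cov, expectAll_switch, cov, ← expectAll_const_mul]
  refine congrArg _ (funext fun α => ?_)
  simp only [centred, val_flipOn, meanAt_switch hT]
  split_ifs <;> ring

end Switch

/-! ### Identifiability -/

section Identifiability

variable {V : Type*} [Fintype V] {T : SimpleGraph V} {r : V} {p : (Leaf T → Bool) → ℝ}
  {θ θ' : Param T r}

/-- Means give variances; with edge covariances they give the slopes `eta`, and the mean of the head
then gives the intercept `cond e false`. -/
theorem param_eq_of_moments (h : Admissible T p) (hθ : θ ∈ fiber T r p) (hθ' : θ' ∈ fiber T r p)
    (hm : ∀ v, meanAt θ v = meanAt θ' v) (hc : ∀ u v, T.Adj u v → cov θ u v = cov θ' u v) :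
    θ = θ' := by
  have hT := h.isTree
  have heta : ∀ e, eta θ e = eta θ' e := fun e => by
    rw [eta_eq_div h hθ, eta_eq_div h hθ', hc _ _ e.2.1, cov_self hT, cov_self hT, hm]
  have hfalse : ∀ e, θ.cond e false = θ'.cond e false := fun e => by
    have h1 := meanAt_arc hT θ e
    have h2 := meanAt_arc hT θ' e
    rw [hm, hm, heta] at h1
    linarith
  refine Param.ext ?_ (funext fun e => funext fun b => ?_)
  · rw [← meanAt_root hT, ← meanAt_root hT, hm]
  · cases b
    · exact hfalse e
    · have := heta e
      rw [eta, eta, hfalse] at this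
      linarith

theorem cov_self_eq (h : Admissible T p) (hθ : θ ∈ fiber T r p) (hθ' : θ' ∈ fiber T r p) {v : V}
    (hv : IsInner T v) : cov θ v v = cov θ' v v := by
  obtain ⟨i, j, k, hs, hne⟩ := exists_separated_triple h hθ hv
  have h1 := muBar_sq_eq h hθ hs hne
  have h2 := muBar_sq_eq h hθ' hs hne
  have h3 := muBar_sq_add h.isTree θ v
  have h4 := muBar_sq_add h.isTree θ' v
  linarith

/-- The covariance of an inner variable with a leaf is determined up to sign. -/
theorem cov_leaf_sq_eq (h : Admissible T p) (hθ : θ ∈ fiber T r p) (hθ' : θ' ∈ fiber T r p)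
    {v : V} (hv : IsInner T v) {i j k : Leaf T} (hs : NodeSeparates₃ T v i j k)
    (hne : mom₂ p i j * mom₂ p i k * mom₂ p j k ≠ 0) : cov θ i v ^ 2 = cov θ' i v ^ 2 := by
  have key : ∀ {θ : Param T r}, θ ∈ fiber T r p →
      cov θ i v ^ 2 * mom₂ p j k = mom₂ p i j * mom₂ p i k * cov θ v v := by
    intro θ hθ
    have h1 := cov_mul_of_separates h.isTree θ hs.1
    have h2 := cov_mul_of_separates h.isTree θ hs.2.1
    have h3 := cov_mul_of_separates h.isTree θ hs.2.2
    rw [← mom₂_of_fiber hθ] at h1 h2 h3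
    rw [cov_comm θ v j] at h1
    rw [cov_comm θ v k] at h2 h3
    refine mul_right_cancel₀ (cov_self_ne_zero h hθ v) ?_
    linear_combination cov θ i v ^ 2 * h3 - cov θ i v * cov θ k v * h1 -
      mom₂ p i j * cov θ v v * h2
  refine mul_right_cancel₀ (mul_ne_zero_iff.1 hne).2 ?_
  rw [key hθ, key hθ', cov_self_eq h hθ hθ' hv]

/-- The distribution of an inner variable and its covariances with the leaves are determined by its
covariance with one leaf. -/
theorem eq_of_cov_leaf_eq (h : Admissible T p) (hθ : θ ∈ fiber T r p) (hθ' : θ' ∈ fiber T r p)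
    {v : V} (hv : IsInner T v) {i j k : Leaf T} (hs : NodeSeparates₃ T v i j k)
    (hne : mom₂ p i j * mom₂ p i k * mom₂ p j k ≠ 0) (heq : cov θ i v = cov θ' i v) :
    meanAt θ v = meanAt θ' v ∧ ∀ x : Leaf T, cov θ x v = cov θ' x v := by
  have hT := h.isTree
  have hU := cov_self_eq h hθ hθ' hv
  have hU0 := cov_self_ne_zero h hθ' v
  obtain ⟨ni, nj, nk⟩ := nodeSeparates₃_cov_ne_zero h hθ' hs hne
  have step : ∀ {x y : Leaf T}, NodeSeparates T v x y → cov θ' y v ≠ 0 → cov θ y v = cov θ' y v →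
      cov θ x v = cov θ' x v := by
    intro x y hxy hy he
    have h1 := cov_mul_of_separates hT θ hxy
    have h2 := cov_mul_of_separates hT θ' hxy
    rw [← mom₂_of_fiber hθ, hU, cov_comm θ v y, he] at h1
    rw [← mom₂_of_fiber hθ', cov_comm θ' v y] at h2
    exact mul_right_cancel₀ hy (h1.symm.trans h2)
  have hj := step (nodeSeparates_comm hs.1) ni heq
  have hk := step (nodeSeparates_comm hs.2.1) ni heq
  refine ⟨?_, fun x => ?_⟩
  -- The variance determines `muBar` only up to sign; the third moment fixes the sign.
  · have h1 := cov₃_mul_of_separates hT θ hs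
    have h2 := cov₃_mul_of_separates hT θ' hs
    rw [← mom₃_of_fiber hθ, hU, heq, hj, hk] at h1
    rw [← mom₃_of_fiber hθ'] at h2
    have := mul_left_cancel₀ (mul_ne_zero (mul_ne_zero ni nj) nk) (h1.symm.trans h2)
    rw [muBar_eq, muBar_eq] at this
    linarith
  -- The leaf `x` cannot be in the branches of both `i` and `j`, so one of them serves as reference.
  · by_cases hx : JoinedOff T v x i
    · refine step ((nodeSeparates_iff hT.connected).2 fun hx' => ?_) nj hj
      exact (nodeSeparates_iff hT.connected).1 hs.1 (hx.symm.trans hx')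
    · exact step ((nodeSeparates_iff hT.connected).2 hx) ni heq

/-- For a leaf `j` beyond `v`, correlated with `v`, the covariance across the edge is `cov u j * cov
v v / cov v j`, all of which is known. -/
theorem cov_adj_eq (h : Admissible T p) (hθ : θ ∈ fiber T r p) (hθ' : θ' ∈ fiber T r p)
    (hm : ∀ v, meanAt θ v = meanAt θ' v) (hc : ∀ v, ∀ x : Leaf T, cov θ x v = cov θ' x v)
    {u v : V} (huv : T.Adj u v) : cov θ u v = cov θ' u v := by
  have hT := h.isTree
  by_cases hi : Isolated p s(u, v)
  · rw [cov_eq_zero_of_isolated h hθ huv hi, cov_eq_zero_of_isolated h hθ' huv hi]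
  obtain ⟨i, j, hij, hsep, -, -, hv⟩ := exists_leaves_of_not_isolated hT huv hi
  rw [mom₂_of_fiber hθ'] at hij
  have nj := ((cov_ne_zero_of_separates h hθ' hv).1
    ((cov_ne_zero_of_separates h hθ' hsep).1 hij).2).2
  have h1 := cov_mul_of_separates hT θ hv
  have h2 := cov_mul_of_separates hT θ' hv
  rw [cov_comm θ u j, hc, cov_self hT, hm, ← cov_self hT, cov_comm θ v j, hc] at h1
  rw [cov_comm θ' u j, cov_comm θ' v j] at h2
  rw [cov_comm θ' v j] at nj
  exact mul_right_cancel₀ nj (h1.symm.trans h2)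

theorem exists_switch_eq (h : Admissible T p) (hθ : θ ∈ fiber T r p) (hθ' : θ' ∈ fiber T r p) :
    ∃ S : Set V, (∀ v ∈ S, IsInner T v) ∧ θ' = switch S θ := by
  classical
  have hT := h.isTree
  choose i j k hs hne using fun v : {v : V // IsInner T v} => exists_separated_triple h hθ v.2
  -- Switch exactly where the covariance with the reference leaf differs; there it can only differ
  -- by sign.
  set S : Set V := {v | ∃ hv : IsInner T v, cov θ' (i ⟨v, hv⟩) v ≠ cov θ (i ⟨v, hv⟩) v} with hSdef
  have hS : ∀ v ∈ S, IsInner T v := fun v hv => hv.1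
  have hsw := switch_mem_fiber hθ hS
  refine ⟨S, hS, ?_⟩
  have hleaf : ∀ x : Leaf T, (x : V) ∉ S := fun x hx => hS x hx x.2
  have hi : ∀ v : {v : V // IsInner T v}, cov θ' (i v) v = cov (switch S θ) (i v) v := by
    rintro ⟨v, hv⟩
    rw [cov_switch hT, if_neg (hleaf _)]
    by_cases hvS : v ∈ S
    · rw [if_pos hvS]
      have := (sq_eq_sq_iff_eq_or_eq_neg.1
        (cov_leaf_sq_eq h hθ' hθ hv (hs ⟨v, hv⟩) (hne ⟨v, hv⟩))).resolve_left hvS.2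
      rw [this]
      ring
    · rw [if_neg hvS]
      simp only [hSdef, Set.mem_ofPred_eq, not_exists, not_not] at hvS
      rw [hvS hv]
      ring
  have key := fun v : {v : V // IsInner T v} =>
    eq_of_cov_leaf_eq h hθ' hsw v.2 (hs v) (hne v) (hi v)
  have hm : ∀ v, meanAt θ' v = meanAt (switch S θ) v := by
    intro v
    by_cases hv : IsLeaf T v
    · rw [← mean_of_fiber hθ' ⟨v, hv⟩, ← mean_of_fiber hsw ⟨v, hv⟩]
    · exact (key ⟨v, hv⟩).1
  have hc : ∀ v, ∀ x : Leaf T, cov θ' x v = cov (switch S θ) x v := by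
    intro v x
    by_cases hv : IsLeaf T v
    · rw [← mom₂_of_fiber hθ' x ⟨v, hv⟩, ← mom₂_of_fiber hsw x ⟨v, hv⟩]
    · exact (key ⟨v, hv⟩).2 x
  exact param_eq_of_moments h hθ' hsw hm fun u v huv => cov_adj_eq h hθ' hsw hm hc huv

end Identifiability

end TreeModel

theorem corollary5p5 {V : Type*} [Fintype V] (T : SimpleGraph V) (hT : T.IsTree) (r : V)
    (hdeg : ∀ v, IsInner T v → 3 ≤ deg T v)
    (p : (Leaf T → Bool) → ℝ) (hp : p ∈ model T r)
    (hnd : ∀ i : Leaf T, mean p i * (1 - mean p i) ≠ 0)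
    (hforest : ∀ v, IsInner T v → 3 ≤ deg (forest p) v) :
    -- all classes of isolated and of non-isolated edges are singletons
    (∀ e ∈ T.edgeSet, edgeClass p e = {e}) ∧
    -- leaves and isolated edges
    (∀ θ ∈ fiber T r p,
      (∀ i : Leaf T, muBar θ i = 1 - 2 * mean p i) ∧
      (∀ e : Arc T r, Isolated p e.edge → eta θ e = 0)) ∧
    -- inner nodes
    (∀ v, IsInner T v →
      (∃ i j k : Leaf T, NodeSeparates₃ T v i j k ∧
        mom₂ p i j * mom₂ p i k * mom₂ p j k ≠ 0) ∧
      ∀ i j k : Leaf T, NodeSeparates₃ T v i j k →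
        mom₂ p i j * mom₂ p i k * mom₂ p j k ≠ 0 →
        disc p i j k ≠ 0 ∧
        ∀ θ ∈ fiber T r p, muBar θ v ^ 2 = mom₃ p i j k ^ 2 / disc p i j k) ∧
    -- terminal edges `(v, i)` that are not isolated
    (∀ (e : Arc T r) (i : Leaf T), IsInner T e.1.1 → e.1.2 = i → ¬ Isolated p e.edge →
      (∃ j k : Leaf T, NodeSeparates₃ T e.1.1 i j k ∧ mom₂ p j k ≠ 0) ∧
      ∀ j k : Leaf T, NodeSeparates₃ T e.1.1 i j k → mom₂ p j k ≠ 0 →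
        ∀ θ ∈ fiber T r p, eta θ e ^ 2 = disc p i j k / mom₂ p j k ^ 2) ∧
    -- inner edges `(u, v)` that are not isolated
    (∀ e : Arc T r, IsInner T e.1.1 → IsInner T e.1.2 → ¬ Isolated p e.edge →
      (∃ i j k l : Leaf T,
        NodeSeparates (forest p) e.1.1 i j ∧ NodeSeparates (forest p) e.1.2 k l ∧
        EdgeSeparates (forest p) e.edge i k ∧ EdgeSeparates (forest p) e.edge i l ∧
        EdgeSeparates (forest p) e.edge j k ∧ EdgeSeparates (forest p) e.edge j l) ∧
      ∀ i j k l : Leaf T,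
        NodeSeparates (forest p) e.1.1 i j → NodeSeparates (forest p) e.1.2 k l →
        EdgeSeparates (forest p) e.edge i k → EdgeSeparates (forest p) e.edge i l →
        EdgeSeparates (forest p) e.edge j k → EdgeSeparates (forest p) e.edge j l →
        mom₂ p i j ≠ 0 ∧ disc p i k l ≠ 0 ∧
        ∀ θ ∈ fiber T r p,
          eta θ e ^ 2 = mom₂ p i l ^ 2 / mom₂ p i j ^ 2 * (disc p i j k / disc p i k l)) ∧
    -- identifiability up to switching the labels of the inner nodes
    (∀ θ ∈ fiber T r p, ∀ θ' : Param T r,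
      θ' ∈ fiber T r p ↔ ∃ S : Set V, (∀ v ∈ S, IsInner T v) ∧ θ' = switch S θ) := by
  have h : Admissible T p := ⟨hT, hnd, hforest⟩
  -- One point of the fiber suffices for the claims about `p` alone, such as the existence of leaves
  -- and the nonvanishing of `disc`.
  obtain ⟨θ₀, hθ₀, hp₀⟩ := hp
  have h₀ : θ₀ ∈ fiber T r p := ⟨hθ₀, hp₀⟩
  refine ⟨fun e he => edgeClass_eq h he, fun θ hθ => ⟨fun i => ?_, fun e he => ?_⟩,
    fun v hv => ⟨exists_separated_triple h h₀ hv, fun i j k hs hne => ⟨?_, fun θ hθ =>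
      muBar_sq_eq h hθ hs hne⟩⟩,
    fun e i he hi hn => ⟨exists_separated_pair h h₀ he (hi ▸ e.2.1), fun j k hs hjk θ hθ =>
      eta_sq_terminal h hθ hi hs hjk⟩,
    fun e hu hv hn => ⟨exists_separated_quadruple h hu hv (forest_adj.2 ⟨e.2.1, hn⟩),
      fun i j k l hij hkl hik hil hjk _ => ?_⟩,
    fun θ hθ θ' => ⟨exists_switch_eq h hθ, ?_⟩⟩
  · rw [muBar_eq, mean_of_fiber hθ]
  · rw [eta_eq_div h hθ, cov_eq_zero_of_isolated h hθ e.2.1 he, zero_div]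
  · obtain ⟨hi, hj, hk⟩ := nodeSeparates₃_cov_ne_zero h h₀ hs hne
    exact disc_ne_zero h h₀ hs hi hj hk
  · have key := fun {θ} (hθ : θ ∈ fiber T r p) => eta_sq_inner h hθ hij hkl hik hil hjk
    exact ⟨(key h₀).1, (key h₀).2.1, fun θ hθ => (key hθ).2.2⟩
  · rintro ⟨S, hS, rfl⟩
    exact switch_mem_fiber hθ hS
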